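/- Let $\mathcal V$ be a (large) category with finite limits which is (infinitary) extensive: $\mathcal V$ has all small coproducts and, for every small family $(X_i)_{i\in I}$ of objects, the functor $\prod_{i\in I}\mathcal V/X_i\to\mathcal V/\coprod_{i\in I}X_i$, $(f_i)_i\mapsto\coprod_i f_i$, is an equivalence of categories. A small $\mathcal V$-graph $G$ consists of a small set $\mathrm{ob}(G)$ and objects $G(x,y)\in\mathcal V$ for $x,y\in\mathrm{ob}(G)$; a morphism $G\to G'$ is a function $f\colon\mathrm{ob}(G)\to\mathrm{ob}(G')$ together with morphisms $f_{x,y}\colon G(x,y)\to G'(fx,fy)$. Let $\mathcal V\text{-}\mathbf{Gph}$ be the category of small $\mathcal V$-graphs and $\mathcal V\text{-}\mathbf{Cat}$ the category of small categories enriched in $\mathcal V$ with its cartesian monoidal structure and $\mathcal V$-functors. Put $$\mathcal V\text{-}\mathbf{Gph}^{(0)}=\mathcal V\text{-}\mathbf{Cat}^{(0)}=\mathcal V,\quad \mathcal V\text{-}\mathbf{Gph}^{(n+1)}=(\mathcal V\text{-}\mathbf{Gph}^{(n)})\text{-}\mathbf{Gph},\quad \mathcal V\text{-}\mathbf{Cat}^{(n+1)}=(\mathcal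 V\text{-}\mathbf{Cat}^{(n)})\text{-}\mathbf{Cat},$$ and let $U^{(n)}\colon\mathcal V\text{-}\mathbf{Cat}^{(n)}\to\mathcal V\text{-}\mathbf{Gph}^{(n)}$ be the forgetful functor, given by $U^{(0)}=\mathrm{id}_{\mathcal V}$ and $U^{(n+1)}=\bigl((\mathcal V\text{-}\mathbf{Cat}^{(n)})\text{-}\mathbf{Cat}\to(\mathcal V\text{-}\mathbf{Cat}^{(n)})\text{-}\mathbf{Gph}\xrightarrow{\,U^{(n)}\text{-}\mathbf{Gph}\,}(\mathcal V\text{-}\mathbf{Gph}^{(n)})\text{-}\mathbf{Gph}\bigr)$, where the first functor forgets identities and composition and $U^{(n)}\text{-}\mathbf{Gph}$ applies $U^{(n)}$ to all hom-objects. Then, for every natural number $n$, the functor $U^{(n)}$ has a left adjoint $F^{(n)}$, and the monad $T^{(n)}=(U^{(n)}F^{(n)},\eta^{(n)},\mu^{(n)})$ on $\mathcal V\text{-}\mathbf{Gph}^{(n)}$ generated by the adjunction $F^{(n)}\dashv U^{(n)}$ (the free strict $n$-dimensional $\mathcal V$-category monad) is cartesian: $\mathcal V\text{-}\mathbf{Gph}^{(n)}$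 has pullbacks, $T^{(n)}$ preserves pullbacks, and all naturality squares of $\eta^{(n)}$ and $\mu^{(n)}$ are pullback squares. -/

import Mathlib

universe w v u v₁ u₁

open CategoryTheory Limits

/-! ### Extensive categories (infinitary version) -/

section Extensive

variable {V : Type u} [Category.{v} V]

/-- The functor `∏ᵢ (V / Xᵢ) ⥤ V / ∐ᵢ Xᵢ` which sends a family `(fᵢ : Aᵢ ⟶ Xᵢ)` to
`∐ᵢ fᵢ : ∐ᵢ Aᵢ ⟶ ∐ᵢ Xᵢ`. -/
noncomputable def overCoprod [HasCoproducts.{w} V] {I : Type w} (X : I → V) :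
    (∀ i, Over (X i)) ⥤ Over (∐ X) where
  obj A := Over.mk (Limits.Sigma.map fun i => (A i).hom)
  map {A B} f := Over.homMk (Limits.Sigma.map fun i => (f i).left) (by
    refine Limits.Sigma.hom_ext _ _ fun i => ?_
    simp)
  map_id A := by
    ext
    simp [Over.homMk]
  map_comp f g := by
    ext
    rw [Over.comp_left]
    refine Limits.Sigma.hom_ext _ _ fun i => ?_
    simp [Over.homMk]

variable (V) in
/-- `V` is extensive: it has all (`w`-)small coproducts, and for every small family `(Xᵢ)` the
functor `∏ᵢ (V / Xᵢ) ⥤ V / ∐ᵢ Xᵢ` is an equivalence. -/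
structure IsExtensive : Prop where
  hasCoproducts : HasCoproducts.{w} V
  isEquivalence : ∀ {I : Type w} (X : I → V), (overCoprod X).IsEquivalence

end Extensive

/-! ### Graphs enriched in a category -/

/-- A small `V`-graph: a small set of objects and an object `hom x y` of `V` for all `x`, `y`. -/
structure VGph (V : Type u) [Category.{v} V] : Type (max u (w + 1)) where
  ob : Type w
  hom : ob → ob → V

namespace VGph

/-- Morphisms of `V`-graphs. -/
structure Hom {V : Type u} [Category.{v} V] (G H : VGph.{w} V) : Type (max v w) where
  obj : G.ob → H.ob
  map : ∀ x y : G.ob, G.hom x y ⟶ H.hom (obj x) (obj y)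

instance (V : Type u) [Category.{v} V] : Category.{max v w} (VGph.{w} V) where
  Hom G H := Hom G H
  id G := { obj := fun x => x, map := fun _ _ => 𝟙 _ }
  comp f g := { obj := fun x => g.obj (f.obj x), map := fun x y => f.map x y ≫ g.map _ _ }
  id_comp f := by simp
  comp_id f := by simp
  assoc f g h := by simp

/-- The functor `V-Gph ⥤ W-Gph` induced by a functor `V ⥤ W`. -/
def mapFunctor {V : Type u} [Category.{v} V] {W : Type u₁} [Category.{v₁} W] (F : V ⥤ W) :
    VGph.{w} V ⥤ VGph.{w} W where
  obj G := { ob := G.ob, hom := fun x y => F.obj (G.hom x y) }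
  map f := { obj := f.obj, map := fun x y => F.map (f.map x y) }
  map_id G := by
    change Hom.mk _ _ = Hom.mk _ _
    congr
    funext x y
    exact F.map_id _
  map_comp f g := by
    change Hom.mk _ _ = Hom.mk _ _
    congr
    funext x y
    exact F.map_comp _ _

end VGph

/-! ### Categories enriched in a category with (chosen) finite products -/

/-- A small `V`-category, where `V` carries its cartesian monoidal structure. -/
structure VCat (V : Type u) [Category.{v} V] [CartesianMonoidalCategory V] :
    Type (max u v (w + 1)) where
  ob : Type w
  [str : EnrichedCategory V ob]

namespace VCat

open MonoidalCategory CartesianMonoidalCategory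

attribute [instance] VCat.str

variable (V : Type u) [Category.{v} V] [CartesianMonoidalCategory V]

instance : Category.{max v w} (VCat.{w} V) where
  Hom C D := EnrichedFunctor V C.ob D.ob
  id C := EnrichedFunctor.id V C.ob
  comp F G := EnrichedFunctor.comp V F G
  id_comp _ := EnrichedFunctor.ext V (fun _ => rfl)
    (fun _ _ => (Category.comp_id _).trans (Category.id_comp _))
  comp_id _ := EnrichedFunctor.ext V (fun _ => rfl)
    (fun _ _ => (Category.comp_id _).trans (Category.comp_id _))
  assoc _ _ _ := EnrichedFunctor.ext V (fun _ => rfl)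
    (fun _ _ => (Category.comp_id _).trans (Category.assoc _ _ _))

/-- The forgetful functor from `V`-categories to `V`-graphs. -/
def forget : VCat.{w} V ⥤ VGph.{w} V where
  obj C := { ob := C.ob, hom := fun x y => EnrichedCategory.Hom x y }
  map F := { obj := EnrichedFunctor.obj F, map := EnrichedFunctor.map F }

variable {V}

/-- The terminal `V`-category: one object, whose hom-object is terminal. -/
def terminal : VCat.{w} V where
  ob := PUnit.{w + 1}
  str :=
    { Hom := fun _ _ => 𝟙_ V
      id := fun _ => 𝟙 _
      comp := fun _ _ _ => toUnit _
      id_comp := fun _ _ => toUnit_unique _ _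
      comp_id := fun _ _ => toUnit_unique _ _
      assoc := fun _ _ _ _ => toUnit_unique _ _ }

/-- The product of two `V`-categories: pairs of objects, products of hom-objects, and
componentwise identities and composition. -/
def prod (C D : VCat.{w} V) : VCat.{w} V where
  ob := C.ob × D.ob
  str :=
    { Hom := fun x y => EnrichedCategory.Hom x.1 y.1 ⊗ EnrichedCategory.Hom x.2 y.2
      id := fun x => lift (eId V x.1) (eId V x.2)
      comp := fun x y z =>
        lift ((fst _ _ ⊗ₘ fst _ _) ≫ eComp V x.1 y.1 z.1)
          ((snd _ _ ⊗ₘ snd _ _) ≫ eComp V x.2 y.2 z.2)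
      id_comp := fun x y => by
        apply CartesianMonoidalCategory.hom_ext
        · have h := fst (EnrichedCategory.Hom x.1 y.1 : V) (EnrichedCategory.Hom x.2 y.2) ≫=
            e_id_comp V x.1 y.1
          simp only [← Category.assoc, Category.comp_id] at h
          simp only [Category.assoc, lift_fst, Category.id_comp]
          refine Eq.trans ?_ h
          simp only [← Category.assoc]
          congr 1
          apply CartesianMonoidalCategory.hom_ext <;> simp
        · have h := snd (EnrichedCategory.Hom x.1 y.1 : V) (EnrichedCategory.Hom x.2 y.2) ≫=
            e_id_comp V x.2 y.2
          simp only [← Category.assoc, Category.comp_id] at h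
          simp only [Category.assoc, lift_snd, Category.id_comp]
          refine Eq.trans ?_ h
          simp only [← Category.assoc]
          congr 1
          apply CartesianMonoidalCategory.hom_ext <;> simp
      comp_id := fun x y => by
        apply CartesianMonoidalCategory.hom_ext
        · have h := fst (EnrichedCategory.Hom x.1 y.1 : V) (EnrichedCategory.Hom x.2 y.2) ≫=
            e_comp_id V x.1 y.1
          simp only [← Category.assoc, Category.comp_id] at h
          simp only [Category.assoc, lift_fst, Category.id_comp]
          refine Eq.trans ?_ h
          simp only [← Category.assoc]
          congr 1
          apply CartesianMonoidalCategory.hom_ext <;> simp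
        · have h := snd (EnrichedCategory.Hom x.1 y.1 : V) (EnrichedCategory.Hom x.2 y.2) ≫=
            e_comp_id V x.2 y.2
          simp only [← Category.assoc, Category.comp_id] at h
          simp only [Category.assoc, lift_snd, Category.id_comp]
          refine Eq.trans ?_ h
          simp only [← Category.assoc]
          congr 1
          apply CartesianMonoidalCategory.hom_ext <;> simp
      assoc := fun x y z t => by
        apply CartesianMonoidalCategory.hom_ext
        · have h := (fst (EnrichedCategory.Hom x.1 y.1 : V) (EnrichedCategory.Hom x.2 y.2) ⊗ₘ
            (fst (EnrichedCategory.Hom y.1 z.1 : V) (EnrichedCategory.Hom y.2 z.2) ⊗ₘ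
             fst (EnrichedCategory.Hom z.1 t.1 : V) (EnrichedCategory.Hom z.2 t.2))) ≫=
            e_assoc V x.1 y.1 z.1 t.1
          simp only [Category.assoc, lift_fst]
          refine Eq.trans ?_ (h.trans ?_)
          · simp only [← Category.assoc]
            congr 1
            apply CartesianMonoidalCategory.hom_ext
            · simp only [Category.assoc, whiskerRight_fst, whiskerRight_fst_assoc, tensorHom_fst,
                lift_fst]
              simp only [← Category.assoc]
              congr 1
              apply CartesianMonoidalCategory.hom_ext <;> simp
            · simp
          · simp only [← Category.assoc]
            congr 1
            apply CartesianMonoidalCategory.hom_ext <;> simp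
        · have h := (snd (EnrichedCategory.Hom x.1 y.1 : V) (EnrichedCategory.Hom x.2 y.2) ⊗ₘ
            (snd (EnrichedCategory.Hom y.1 z.1 : V) (EnrichedCategory.Hom y.2 z.2) ⊗ₘ
             snd (EnrichedCategory.Hom z.1 t.1 : V) (EnrichedCategory.Hom z.2 t.2))) ≫=
            e_assoc V x.2 y.2 z.2 t.2
          simp only [Category.assoc, lift_snd]
          refine Eq.trans ?_ (h.trans ?_)
          · simp only [← Category.assoc]
            congr 1
            apply CartesianMonoidalCategory.hom_ext
            · simp only [Category.assoc, whiskerRight_fst, whiskerRight_fst_assoc, tensorHom_fst,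
                lift_snd]
              simp only [← Category.assoc]
              congr 1
              apply CartesianMonoidalCategory.hom_ext <;> simp
            · simp
          · simp only [← Category.assoc]
            congr 1
            apply CartesianMonoidalCategory.hom_ext <;> simp }

/-- The first projection from a product of `V`-categories. -/
def prodFst (C D : VCat.{w} V) : prod C D ⟶ C :=
  { obj := fun x => x.1
    map := fun _ _ => fst _ _
    map_id := fun _ => lift_fst _ _
    map_comp := fun _ _ _ => lift_fst _ _ : EnrichedFunctor V (prod C D).ob C.ob }

/-- The second projection from a product of `V`-categories. -/
def prodSnd (C D : VCat.{w} V) : prod C D ⟶ D :=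
  { obj := fun x => x.2
    map := fun _ _ => snd _ _
    map_id := fun _ => lift_snd _ _
    map_comp := fun _ _ _ => lift_snd _ _ : EnrichedFunctor V (prod C D).ob D.ob }

/-- The `V`-functor into a product induced by a pair of `V`-functors. -/
def prodLift {B C D : VCat.{w} V} (F : B ⟶ C) (G : B ⟶ D) : B ⟶ prod C D :=
  { obj := fun x => (EnrichedFunctor.obj F x, EnrichedFunctor.obj G x)
    map := fun x y => lift (EnrichedFunctor.map F x y) (EnrichedFunctor.map G x y)
    map_id := fun x => (comp_lift _ _ _).trans
      (congrArg₂ lift (EnrichedFunctor.map_id F x) (EnrichedFunctor.map_id G x))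
    map_comp := fun x y z => by
      refine (comp_lift _ _ _).trans ((congrArg₂ lift (EnrichedFunctor.map_comp F x y z)
        (EnrichedFunctor.map_comp G x y z)).trans ?_)
      refine Eq.trans ?_ (comp_lift _ _ _).symm
      congr 1
      · exact (congrArg (· ≫ eComp V _ _ _) (by simp)).trans (Category.assoc
          (lift (EnrichedFunctor.map F x y) (EnrichedFunctor.map G x y) ⊗ₘ
            lift (EnrichedFunctor.map F y z) (EnrichedFunctor.map G y z)) (fst _ _ ⊗ₘ fst _ _) _)
      · exact (congrArg (· ≫ eComp V _ _ _) (by simp)).trans (Category.assoc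
          (lift (EnrichedFunctor.map F x y) (EnrichedFunctor.map G x y) ⊗ₘ
            lift (EnrichedFunctor.map F y z) (EnrichedFunctor.map G y z)) (snd _ _ ⊗ₘ snd _ _) _) : EnrichedFunctor V B.ob (prod C D).ob }

/-- Finite products of `V`-categories, chosen to be the explicit ones above. -/
instance : CartesianMonoidalCategory (VCat.{w} V) :=
  .ofChosenFiniteProducts
    { cone := asEmptyCone terminal
      isLimit := IsTerminal.ofUniqueHom
        (fun C =>
          { obj := fun _ => PUnit.unit
            map := fun _ _ => toUnit _
            map_id := fun _ => toUnit_unique _ _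
            map_comp := fun _ _ _ => toUnit_unique _ _ :
              EnrichedFunctor V C.ob (terminal (V := V)).ob })
        (fun C F => EnrichedFunctor.ext V (fun _ => rfl) (fun _ _ => toUnit_unique _ _)) }
    (fun C D =>
      { cone := BinaryFan.mk (prodFst C D) (prodSnd C D)
        isLimit := BinaryFan.isLimitMk (fun s => prodLift s.fst s.snd)
          (fun s => EnrichedFunctor.ext V (fun _ => rfl)
            (fun x y => (Category.comp_id _).trans (lift_fst _ _)))
          (fun s => EnrichedFunctor.ext V (fun _ => rfl)
            (fun x y => (Category.comp_id _).trans (lift_snd _ _)))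
          (fun s m h₁ h₂ => by
            rw [← h₁, ← h₂]
            refine EnrichedFunctor.ext V (fun _ => rfl) (fun x y => ?_)
            refine (Category.comp_id _).trans ?_
            apply CartesianMonoidalCategory.hom_ext
            · exact (lift_fst _ _).symm
            · exact (lift_snd _ _).symm) })

end VCat

/-! ### Iteration -/

section Iterate

set_option linter.checkUnivs false

/-- A category with chosen finite products, bundled. -/
structure CartCat : Type (max (u + 1) (v + 1)) where
  carrier : Type u
  [cat : Category.{v} carrier]
  [cart : CartesianMonoidalCategory carrier]

attribute [instance] CartCat.cat CartCat.cart

variable (V : Type (max u v (w + 1))) [Category.{max v w} V]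

/-- The category `V-Gph⁽ⁿ⁾` of `n`-dimensional `V`-graphs, bundled:
`V-Gph⁽⁰⁾ = V` and `V-Gph⁽ⁿ⁺¹⁾ = (V-Gph⁽ⁿ⁾)-Gph`. -/
def nGphCat : ℕ → Cat.{max v w, max u v (w + 1)}
  | 0 => Cat.of V
  | n + 1 => Cat.of (VGph.{w} (nGphCat n))

/-- The category of `n`-dimensional `V`-graphs. -/
abbrev NGph (n : ℕ) : Type (max u v (w + 1)) := nGphCat.{w, v, u} V n

variable [CartesianMonoidalCategory V]

/-- The category `V-Cat⁽ⁿ⁾` of strict `n`-dimensional `V`-categories, bundled with its finite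
products: `V-Cat⁽⁰⁾ = V` and `V-Cat⁽ⁿ⁺¹⁾ = (V-Cat⁽ⁿ⁾)-Cat`. -/
def nCatCat : ℕ → CartCat.{max v w, max u v (w + 1)}
  | 0 => { carrier := V }
  | n + 1 => { carrier := VCat.{w} (nCatCat n).carrier }

/-- The category of strict `n`-dimensional `V`-categories. -/
abbrev NCat (n : ℕ) : Type (max u v (w + 1)) := (nCatCat.{w, v, u} V n).carrier

/-- The forgetful functor `U⁽ⁿ⁾ : V-Cat⁽ⁿ⁾ ⥤ V-Gph⁽ⁿ⁾`: `U⁽⁰⁾` is the identity and `U⁽ⁿ⁺¹⁾` is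
the composite
`(V-Cat⁽ⁿ⁾)-Cat ⥤ (V-Cat⁽ⁿ⁾)-Gph ⥤ (V-Gph⁽ⁿ⁾)-Gph` of the forgetful functor and `U⁽ⁿ⁾-Gph`. -/
def nForget : ∀ n : ℕ, NCat.{w, v, u} V n ⥤ NGph.{w, v, u} V n
  | 0 => 𝟭 V
  | n + 1 =>
      VCat.forget.{w} (NCat.{w, v, u} V n) ⋙ VGph.mapFunctor.{w} (nForget n)

end Iterate

/-! ### Cartesian monads -/

/-- A monad on a category with pullbacks is cartesian if its functor part preserves pullbacks and
all naturality squares of its unit and multiplication are pullbacks. -/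
structure IsCartesianMonad {C : Type u} [Category.{v} C] (T : Monad C) : Prop where
  hasPullbacks : HasPullbacks C
  preservesPullbacks : PreservesLimitsOfShape WalkingCospan T.toFunctor
  unit_cartesian : NatTrans.Equifibered T.η
  mul_cartesian : NatTrans.Equifibered T.μ

/-! A free category is a sum over path lengths. On a fixed object set, the hom-objects of a graph
form a matrix M; matrices multiply by (MN)(x,z) = ∐_y M(x,y) ⊗ N(y,z), and the free category on the
graph has the matrix `star M` = ∐_n M^n. Extensivity is used in the form `HasVanKampenCoproducts`:
coproducts are stable under pullback, so products distribute over them, and every summand inclusion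
of a coproduct of maps is part of a pullback square. Hence coproducts of pullback squares are
pullback squares, even along a map of index sets (`isPullback_reindex`), and cartesianness can be
checked on summands.

A graph map preserves the length of a path, and any decomposition of the image of a path comes from
a unique decomposition of the path itself. This makes the squares for one-edge paths and for
concatenation pullbacks (`isPullback_starη`, `isPullback_starμ`). Paths in a fibre product of graphs
are pairs of paths with the same image, so the free category functor preserves pullbacks
(`isPullback_starMap`).

For the iteration, the left adjoint at stage n + 1 is F-Gph followed by the free category functor,
where F ⊣ U is the adjunction at stage n. The multiplication is U applied to the counit at free
objects, so the counit must be cartesian at maps F f. For the composite adjunction its square pastes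
together two squares. One comes from the free category adjunction; the other needs the counit of F ⊣
U to be cartesian at `starMap (F f)`, which is not of the form F g. This holds because the maps at
which the counit is cartesian are closed under products, if F preserves pullbacks, and under
coproducts, if U preserves coproducts. These preservation properties are therefore part of the
inductive statement `IsCartesianForgetful`, propagated by `IsCartesianForgetful.step`. -/

open MonoidalCategory CartesianMonoidalCategory

/-! ### Coproduct diagrams -/

section Coproducts

variable {A : Type u} [Category.{v} A]

/-- The maps `ι i : X i ⟶ S` exhibit `S` as a coproduct of the family `X`. -/
def IsCoprod {I : Type*} (X : I → A) {S : A} (ι : ∀ i, X i ⟶ S) : Prop :=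
  ∀ (Z : A) (f : ∀ i, X i ⟶ Z), ∃! g : S ⟶ Z, ∀ i, ι i ≫ g = f i

namespace IsCoprod

variable {I : Type*} {X : I → A} {S : A} {ι : ∀ i, X i ⟶ S}

/-- The map out of a coproduct induced by a family of maps. -/
noncomputable def desc (h : IsCoprod X ι) {Z : A} (f : ∀ i, X i ⟶ Z) : S ⟶ Z :=
  (h Z f).choose

@[simp]
lemma ι_desc (h : IsCoprod X ι) {Z : A} (f : ∀ i, X i ⟶ Z) (i : I) : ι i ≫ h.desc f = f i :=
  (h Z f).choose_spec.1 i

@[simp]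
lemma ι_desc_assoc (h : IsCoprod X ι) {Z W : A} (f : ∀ i, X i ⟶ Z) (i : I) (k : Z ⟶ W) :
    ι i ≫ h.desc f ≫ k = f i ≫ k := by
  rw [← Category.assoc, ι_desc]

lemma hom_ext (h : IsCoprod X ι) {Z : A} {f g : S ⟶ Z} (w : ∀ i, ι i ≫ f = ι i ≫ g) : f = g :=
  (h Z fun i => ι i ≫ g).unique w fun _ => rfl

lemma of_isColimit {c : Cofan X} (h : IsColimit c) : IsCoprod X c.inj := fun Z f =>
  ⟨Cofan.IsColimit.desc h f, Cofan.IsColimit.fac h f, fun g hg =>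
    Cofan.IsColimit.hom_ext h _ _ fun i => by rw [hg, Cofan.IsColimit.fac]⟩

/-- A coproduct diagram is a colimit cofan. -/
noncomputable def isColimit (h : IsCoprod X ι) : IsColimit (Cofan.mk S ι) :=
  Cofan.IsColimit.mk _ (fun s => h.desc s.inj) (fun _ i => h.ι_desc _ i)
    (fun _ _ w => h.hom_ext fun i => (w i).trans (h.ι_desc _ i).symm)

lemma map {B : Type u₁} [Category.{v₁} B] (h : IsCoprod X ι) (F : A ⥤ B)
    [PreservesColimitsOfShape (Discrete I) F] :
    IsCoprod (fun i => F.obj (X i)) (fun i => F.map (ι i)) :=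
  of_isColimit (isColimitCofanMkObjOfIsColimit F X _ h.isColimit)

lemma of_map {B : Type u₁} [Category.{v₁} B] (F : A ⥤ B)
    [ReflectsColimitsOfShape (Discrete I) F]
    (h : IsCoprod (fun i => F.obj (X i)) (fun i => F.map (ι i))) : IsCoprod X ι :=
  of_isColimit (isColimitOfIsColimitCofanMkObj F X ι h.isColimit)

lemma comp_iso (h : IsCoprod X ι) {T : A} (e : S ≅ T) : IsCoprod X fun i => ι i ≫ e.hom :=
  fun _ f => ⟨e.inv ≫ h.desc f, fun i => by simp, fun g hg => by
    rw [← cancel_epi e.hom]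
    exact h.hom_ext fun i => by simpa using hg i⟩

lemma comp_isIso (h : IsCoprod X ι) {T : A} (e : S ⟶ T) [IsIso e] :
    IsCoprod X fun i => ι i ≫ e :=
  h.comp_iso (asIso e)

lemma iso_comp (h : IsCoprod X ι) {Y : I → A} (e : ∀ i, Y i ≅ X i) :
    IsCoprod Y fun i => (e i).hom ≫ ι i :=
  fun _ f => ⟨h.desc fun i => (e i).inv ≫ f i, fun i => by simp, fun g hg =>
    h.hom_ext fun i => by simp [← hg i]⟩

/-- Two coproducts of the same family are isomorphic. -/
lemma isIso_of_comp {T : A} {κ : ∀ i, X i ⟶ T} (h : IsCoprod X ι) (h' : IsCoprod X κ)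
    (e : S ⟶ T) (he : ∀ i, ι i ≫ e = κ i) : IsIso e :=
  ⟨h'.desc ι, h.hom_ext fun i => by rw [reassoc_of% (he i)]; simp,
    h'.hom_ext fun i => by simp [he]⟩

lemma trans {F : I → Type*} {Y : ∀ i, F i → A} {κ : ∀ i j, Y i j ⟶ X i}
    (h : IsCoprod X ι) (h' : ∀ i, IsCoprod (Y i) (κ i)) :
    IsCoprod (fun p : Σ i, F i => Y p.1 p.2) (fun p => κ p.1 p.2 ≫ ι p.1) := fun Z f =>
  ⟨h.desc fun i => (h' i).desc fun j => f ⟨i, j⟩, fun p => by simp, fun g hg =>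
    h.hom_ext fun i => (h' i).hom_ext fun j => by simpa using hg ⟨i, j⟩⟩

/-- Cancellation counterpart of `trans`. Together they allow a double coproduct to be summed in
either order, for instance by path length instead of by intermediate object. -/
lemma of_trans {F : I → Type*} {Y : ∀ i, F i → A} {κ : ∀ i j, Y i j ⟶ X i}
    {m : ∀ p : Σ i, F i, Y p.1 p.2 ⟶ S}
    (h : IsCoprod (fun p : Σ i, F i => Y p.1 p.2) m) (h' : ∀ i, IsCoprod (Y i) (κ i))
    (hm : ∀ i j, κ i j ≫ ι i = m ⟨i, j⟩) : IsCoprod X ι := fun Z f =>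
  ⟨h.desc fun p => κ p.1 p.2 ≫ f p.1, fun i => (h' i).hom_ext fun j => by
      rw [← Category.assoc, hm, h.ι_desc],
    fun g hg => h.hom_ext fun p => by rw [h.ι_desc, ← hm, Category.assoc, hg]⟩

lemma reindex {J : Type*} (h : IsCoprod X ι) (e : J ≃ I) :
    IsCoprod (fun j => X (e j)) (fun j => ι (e j)) := fun Z f => by
  -- The family is transported along `e` once, so that no cast appears in the rest of the argument.
  obtain ⟨f, rfl⟩ : ∃ f' : ∀ i, X i ⟶ Z, f = fun j => f' (e j) :=
    ⟨fun i => eqToHom (by simp) ≫ f (e.symm i), funext fun j => by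
      have : ∀ j' (hj : j' = j) (hX : X (e j) = X (e j')),
          eqToHom hX ≫ f j' = f j := by
        rintro _ rfl _; simp
      exact (this _ (by simp) _).symm⟩
  exact ⟨h.desc f, fun j => h.ι_desc _ _, fun g hg => h.hom_ext fun i => by
    obtain ⟨j, rfl⟩ := e.surjective i
    rw [hg, h.ι_desc]⟩

lemma of_isInitial {X : PEmpty.{w + 1} → A} {ι : ∀ i, X i ⟶ S} (h : IsInitial S) :
    IsCoprod X ι :=
  fun _ _ => ⟨h.to _, fun i => i.elim, fun _ _ => h.hom_ext _ _⟩

lemma isInitial [IsEmpty I] (h : IsCoprod X ι) : Nonempty (IsInitial S) :=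
  ⟨IsInitial.ofUniqueHom (fun _ => h.desc isEmptyElim) fun _ _ => h.hom_ext isEmptyElim⟩

end IsCoprod

lemma isCoprod_sigma {I : Type w} [HasCoproducts.{w} A] (X : I → A) :
    IsCoprod X (Limits.Sigma.ι X) :=
  IsCoprod.of_isColimit (coproductIsCoproduct X)

end Coproducts

/-! ### Universal and disjoint coproducts -/

section Ext

/-- Small coproducts in `A` are stable under pullback and disjoint. -/
structure HasVanKampenCoproducts (A : Type u) [Category.{v} A] : Prop where
  hasCoproducts : HasCoproducts.{w} A
  univ : ∀ {I : Type w} {X : I → A} {S : A} {ι : ∀ i, X i ⟶ S}, IsCoprod X ι →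
    ∀ {D : A} {g : D ⟶ S} {P : I → A} {p : ∀ i, P i ⟶ D} {q : ∀ i, P i ⟶ X i},
      (∀ i, IsPullback (p i) (q i) g (ι i)) → IsCoprod P p
  disj : ∀ {I : Type w} {X Y : I → A} {S T : A} {ι : ∀ i, X i ⟶ S} {κ : ∀ i, Y i ⟶ T},
    IsCoprod X ι → IsCoprod Y κ → ∀ {f : ∀ i, Y i ⟶ X i} {F : T ⟶ S},
      (∀ i, κ i ≫ F = f i ≫ ι i) → ∀ i, IsPullback (κ i) (f i) F (ι i)

attribute [local simp] pullback.lift_fst pullback.lift_snd pullback.lift_fst_assoc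
  pullback.lift_snd_assoc

lemma CategoryTheory.IsPullback.of_isIso_lift {A : Type u} [Category.{v} A] [HasPullbacks A]
    {P X Y Z : A} {f : X ⟶ Z} {g : Y ⟶ Z} {a : P ⟶ X} {b : P ⟶ Y} (h : a ≫ f = b ≫ g)
    (hi : IsIso (pullback.lift a b h)) : IsPullback a b f g :=
  IsPullback.of_iso (IsPullback.of_hasPullback f g) (asIso (pullback.lift a b h)).symm
    (Iso.refl _) (Iso.refl _) (Iso.refl _) (by simp) (by simp) (by simp) (by simp)

namespace HasVanKampenCoproducts

variable {A : Type u} [Category.{v} A] (hA : HasVanKampenCoproducts.{w} A)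

include hA

/-- Initial objects are strict. -/
lemma isInitial_of_hom {Z D : A} (hZ : IsInitial Z) (g : D ⟶ Z) : Nonempty (IsInitial D) :=
  (hA.univ (I := PEmpty) (X := fun _ => Z) (ι := fun _ => 𝟙 _) (.of_isInitial hZ)
    (g := g) (P := fun _ => Z) (p := fun i => i.elim) (q := fun i => i.elim)
    (fun i => i.elim)).isInitial

/-- Distributivity is universality along the projection `Z ⊗ S ⟶ S`: the square of projections over
each `ι i` is a pullback. -/
lemma tensorLeft [CartesianMonoidalCategory A] (Z : A) {I : Type w} {X : I → A} {S : A}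
    {ι : ∀ i, X i ⟶ S} (h : IsCoprod X ι) : IsCoprod (fun i => Z ⊗ X i) (fun i => Z ◁ ι i) :=
  hA.univ h (g := snd Z S) (q := fun i => snd _ _) fun i =>
    { w := by simp
      isLimit' := ⟨PullbackCone.IsLimit.mk _ (fun s => lift (s.fst ≫ fst _ _) s.snd)
        (fun s => by ext <;> simp [s.condition]) (fun s => by simp) (fun s m h₁ h₂ => by
          ext
          · simp [← h₁]
          · simp [← h₂])⟩ }

lemma tensorRight [CartesianMonoidalCategory A] (Z : A) {I : Type w} {X : I → A} {S : A}
    {ι : ∀ i, X i ⟶ S} (h : IsCoprod X ι) : IsCoprod (fun i => X i ⊗ Z) (fun i => ι i ▷ Z) :=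
  hA.univ h (g := fst S Z) (q := fun i => fst _ _) fun i =>
    { w := by simp
      isLimit' := ⟨PullbackCone.IsLimit.mk _ (fun s => lift s.snd (s.fst ≫ snd _ _))
        (fun s => by ext <;> simp [s.condition]) (fun s => by simp) (fun s m h₁ h₂ => by
          ext
          · simp [← h₂]
          · simp [← h₁])⟩ }

variable [HasPullbacks A]

/-- A coproduct over a map `r : I → J` of index sets of pullback squares is a pullback square. -/
lemma isPullback_reindex {I J : Type w} (r : I → J) {X : I → A} {Y : I → A} {Z W : J → A}
    {SX SY SZ SW : A} {x : ∀ i, X i ⟶ SX} {y : ∀ i, Y i ⟶ SY} {z : ∀ j, Z j ⟶ SZ}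
    {k : ∀ j, W j ⟶ SW} (hx : IsCoprod X x) (hy : IsCoprod Y y) (hz : IsCoprod Z z)
    (hw : IsCoprod W k) {t : ∀ i, X i ⟶ Z (r i)} {l : ∀ i, X i ⟶ Y i} {m : ∀ j, Z j ⟶ W j}
    {b : ∀ i, Y i ⟶ W (r i)} (H : ∀ i, IsPullback (t i) (l i) (m (r i)) (b i))
    {T : SX ⟶ SZ} {L : SX ⟶ SY} {M : SZ ⟶ SW} {B : SY ⟶ SW}
    (hT : ∀ i, x i ≫ T = t i ≫ z (r i)) (hL : ∀ i, x i ≫ L = l i ≫ y i)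
    (hM : ∀ j, z j ≫ M = m j ≫ k j) (hB : ∀ i, y i ≫ B = b i ≫ k (r i)) :
    IsPullback T L M B := by
  have w : T ≫ M = L ≫ B := hx.hom_ext fun i => by
    rw [reassoc_of% (hT i), hM, reassoc_of% (hL i), hB, reassoc_of% (H i).w]
  -- Disjointness makes the square of `M` over each `k j` a pullback; pasting exhibits `X i` as the
  -- pullback of `M` along the restriction of `B` to `Y i`.
  have big : ∀ i, IsPullback (t i ≫ z (r i)) (l i) M (b i ≫ k (r i)) := fun i =>
    (H i).paste_horiz (hA.disj hw hz hM (r i))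
  have hs : ∀ i, (t i ≫ z (r i)) ≫ M = (l i ≫ y i) ≫ B := fun i => by
    rw [(big i).w, Category.assoc, hB]
  -- Thus `X i` is also the part of the chosen pullback of `M` and `B` lying over `Y i`, and
  -- universality makes that pullback the coproduct of the `X i`.
  have key : ∀ i, IsPullback (pullback.lift (t i ≫ z (r i)) (l i ≫ y i) (hs i)) (l i)
      (pullback.snd M B) (y i) := fun i => by
    refine IsPullback.of_right ?_ (by simp) (IsPullback.of_hasPullback M B)
    simpa [hB] using big i
  refine .of_isIso_lift w (hx.isIso_of_comp (hA.univ hy key) _ fun i => ?_)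
  ext <;> simp [hT, hL]

/-- If the maps `X i ⟶ P` over `Y i ⟶ Q` form pullback squares, then so does `∐ X ⟶ P` over
`∐ Y ⟶ Q`. -/
lemma isPullback_desc {I : Type w} {X Y : I → A} {SX SY P Q : A} {x : ∀ i, X i ⟶ SX}
    {y : ∀ i, Y i ⟶ SY} (hx : IsCoprod X x) (hy : IsCoprod Y y) {t : ∀ i, X i ⟶ Y i}
    {l : ∀ i, X i ⟶ P} {m : ∀ i, Y i ⟶ Q} {B : P ⟶ Q}
    (H : ∀ i, IsPullback (t i) (l i) (m i) B) {T : SX ⟶ SY} {L : SX ⟶ P} {M : SY ⟶ Q}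
    (hT : ∀ i, x i ≫ T = t i ≫ y i) (hL : ∀ i, x i ≫ L = l i) (hM : ∀ i, y i ≫ M = m i) :
    IsPullback T L M B := by
  have w : T ≫ M = L ≫ B := hx.hom_ext fun i => by
    rw [reassoc_of% (hT i), hM, reassoc_of% (hL i), (H i).w]
  have hs : ∀ i, (t i ≫ y i) ≫ M = l i ≫ B := fun i => by
    rw [Category.assoc, hM, (H i).w]
  -- Here `X i` is the part of the chosen pullback lying over the summand `Y i`, so universality
  -- applies along the first projection.
  have key : ∀ i, IsPullback (pullback.lift (t i ≫ y i) (l i) (hs i)) (t i)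
      (pullback.fst M B) (y i) := fun i => by
    refine (IsPullback.of_right ?_ (by simp) (IsPullback.of_hasPullback M B).flip)
    simpa [hM] using (H i).flip
  refine .of_isIso_lift w (hx.isIso_of_comp (hA.univ hy key) _ fun i => ?_)
  ext <;> simp [hT, hL]

/-- Coproducts commute with fibre products over a fixed object. -/
lemma isPullback_prod {I J : Type w} {X : I → A} {Y : J → A} {P : I × J → A} {SX SY SP Z : A}
    {x : ∀ i, X i ⟶ SX} {y : ∀ j, Y j ⟶ SY} {p : ∀ k, P k ⟶ SP}
    (hx : IsCoprod X x) (hy : IsCoprod Y y) (hp : IsCoprod P p)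
    {a : ∀ k, P k ⟶ X k.1} {b : ∀ k, P k ⟶ Y k.2} {f : SX ⟶ Z} {g : SY ⟶ Z}
    (H : ∀ k, IsPullback (a k) (b k) (x k.1 ≫ f) (y k.2 ≫ g)) {T : SP ⟶ SX} {L : SP ⟶ SY}
    (hT : ∀ k, p k ≫ T = a k ≫ x k.1) (hL : ∀ k, p k ≫ L = b k ≫ y k.2) :
    IsPullback T L f g := by
  have w : T ≫ f = L ≫ g := hp.hom_ext fun k => by
    rw [reassoc_of% (hT k), reassoc_of% (hL k), (H k).w]
  have h₁ : ∀ k, a k ≫ x k.1 ≫ f = (b k ≫ y k.2) ≫ g := fun k => by simpa using (H k).w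
  have key₁ : ∀ i j, IsPullback (pullback.lift (a (i, j)) (b (i, j) ≫ y j) (h₁ (i, j)))
      (b (i, j)) (pullback.snd (x i ≫ f) g) (y j) := fun i j =>
    IsPullback.of_right (by simpa using H (i, j)) (by simp) (IsPullback.of_hasPullback _ _)
  -- Universality is used twice: first to split the pullback of `X i` against the whole of `SY` over
  -- the index `j`, then to split the full pullback over `i`.
  have c₁ : ∀ i, IsCoprod (fun j => P (i, j))
      (fun j => pullback.lift (f := x i ≫ f) (g := g) (a (i, j)) (b (i, j) ≫ y j)
        (h₁ (i, j))) := fun i => hA.univ hy (q := fun j => b (i, j)) (key₁ i)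
  have h₂ : ∀ i, (pullback.fst (x i ≫ f) g ≫ x i) ≫ f = pullback.snd (x i ≫ f) g ≫ g := fun i => by
    simpa using pullback.condition
  have key₂ : ∀ i, IsPullback (pullback.lift (pullback.fst (x i ≫ f) g ≫ x i)
      (pullback.snd (x i ≫ f) g) (h₂ i)) (pullback.fst (x i ≫ f) g) (pullback.fst f g) (x i) :=
    fun i => (IsPullback.of_right (by simpa using (IsPullback.of_hasPullback (x i ≫ f) g).flip)
      (by simp) (IsPullback.of_hasPullback f g).flip)
  have c₂ := ((hA.univ hx key₂).trans c₁).reindex (Equiv.sigmaEquivProd I J).symm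
  refine .of_isIso_lift w (hp.isIso_of_comp c₂ _ fun k => ?_)
  ext
  · simp only [Equiv.sigmaEquivProd, Category.assoc, pullback.lift_fst, hT]
    exact (pullback.lift_fst_assoc _ _ _ _).symm
  · simp only [Equiv.sigmaEquivProd, Category.assoc, pullback.lift_snd, hL]
    exact (pullback.lift_snd _ _ _).symm

/-- Coproducts of pullback squares indexed by a pullback of sets are pullback squares. -/
lemma isPullback_sigma {K : Type w} {F E : K → Type w} {X : (Σ k, F k) → A} {Y : (Σ k, E k) → A}
    {Z : K → A} {P : (Σ k, F k × E k) → A} {SX SY SZ SP : A}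
    {x : ∀ i, X i ⟶ SX} {y : ∀ i, Y i ⟶ SY} {z : ∀ k, Z k ⟶ SZ} {p : ∀ i, P i ⟶ SP}
    (hx : IsCoprod X x) (hy : IsCoprod Y y) (hz : IsCoprod Z z) (hp : IsCoprod P p)
    {a : ∀ i, P i ⟶ X ⟨i.1, i.2.1⟩} {b : ∀ i, P i ⟶ Y ⟨i.1, i.2.2⟩}
    {f : ∀ i, X i ⟶ Z i.1} {g : ∀ i, Y i ⟶ Z i.1}
    (H : ∀ i, IsPullback (a i) (b i) (f ⟨i.1, i.2.1⟩) (g ⟨i.1, i.2.2⟩))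
    {T : SP ⟶ SX} {L : SP ⟶ SY} {M : SX ⟶ SZ} {B : SY ⟶ SZ}
    (hT : ∀ i, p i ≫ T = a i ≫ x _) (hL : ∀ i, p i ≫ L = b i ≫ y _)
    (hM : ∀ i, x i ≫ M = f i ≫ z _) (hB : ∀ i, y i ≫ B = g i ≫ z _) :
    IsPullback T L M B := by
  have := hA.hasCoproducts
  -- Summing first over the fibres above each `k` separates the problem: products of fibres are
  -- handled by `isPullback_prod`, and the remaining sum over `K` by `isPullback_reindex`.
  let cX : ∀ k, IsCoprod (fun i => X ⟨k, i⟩) _ := fun k => isCoprod_sigma _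
  let cY : ∀ k, IsCoprod (fun i => Y ⟨k, i⟩) _ := fun k => isCoprod_sigma _
  let cP : ∀ k, IsCoprod (fun i => P ⟨k, i⟩) _ := fun k => isCoprod_sigma _
  have sX := IsCoprod.of_trans (ι := fun k => (cX k).desc fun i => x ⟨k, i⟩) hx cX (by simp)
  have sY := IsCoprod.of_trans (ι := fun k => (cY k).desc fun i => y ⟨k, i⟩) hy cY (by simp)
  have sP := IsCoprod.of_trans (ι := fun k => (cP k).desc fun i => p ⟨k, i⟩) hp cP (by simp)
  have sq : ∀ k, IsPullback
      ((cP k).desc fun i => a ⟨k, i⟩ ≫ Limits.Sigma.ι (fun i => X ⟨k, i⟩) i.1)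
      ((cP k).desc fun i => b ⟨k, i⟩ ≫ Limits.Sigma.ι (fun i => Y ⟨k, i⟩) i.2)
      ((cX k).desc fun i => f ⟨k, i⟩) ((cY k).desc fun i => g ⟨k, i⟩) := fun k =>
    hA.isPullback_prod (cX k) (cY k) (cP k) (a := fun i => a ⟨k, i⟩) (b := fun i => b ⟨k, i⟩)
      (fun i => by simpa using H ⟨k, i⟩) (by simp) (by simp)
  refine hA.isPullback_reindex id sP sY sX hz (m := fun k => (cX k).desc fun i => f ⟨k, i⟩) sq
    ?_ ?_ ?_ ?_
  · exact fun k => (cP k).hom_ext fun i => by simp [hT]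
  · exact fun k => (cP k).hom_ext fun i => by simp [hL]
  · exact fun k => (cX k).hom_ext fun i => by simp [hM]
  · exact fun k => (cY k).hom_ext fun i => by simp [hB]

end HasVanKampenCoproducts

end Ext

/-! ### The category of graphs -/

lemma CategoryTheory.IsPullback.of_existsUnique {A : Type u} [Category.{v} A] {P X Y Z : A}
    {a : P ⟶ X} {b : P ⟶ Y} {f : X ⟶ Z} {g : Y ⟶ Z} (h : a ≫ f = b ≫ g)
    (H : ∀ (W : A) (s : W ⟶ X) (t : W ⟶ Y), s ≫ f = t ≫ g →
      ∃! m : W ⟶ P, m ≫ a = s ∧ m ≫ b = t) : IsPullback a b f g where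
  w := h
  isLimit' := ⟨PullbackCone.IsLimit.mk _ (fun s => (H _ _ _ s.condition).choose)
    (fun s => (H _ _ _ s.condition).choose_spec.1.1)
    (fun s => (H _ _ _ s.condition).choose_spec.1.2)
    (fun s _ h₁ h₂ => (H _ _ _ s.condition).unique ⟨h₁, h₂⟩
      (H _ _ _ s.condition).choose_spec.1)⟩

/-- Pullbacks of a cospan are unique up to isomorphism, so one well-chosen pullback per cospan is
enough. -/
lemma preservesPullbacks_of_exists {A : Type u} [Category.{v} A] {B : Type u₁} [Category.{v₁} B]
    (Φ : A ⥤ B) (H : ∀ {X Y Z : A} (f : X ⟶ Z) (g : Y ⟶ Z), ∃ (P : A) (a : P ⟶ X) (b : P ⟶ Y),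
      IsPullback a b f g ∧ IsPullback (Φ.map a) (Φ.map b) (Φ.map f) (Φ.map g)) :
    PreservesLimitsOfShape WalkingCospan Φ := by
  have key : ∀ {X Y Z : A} (f : X ⟶ Z) (g : Y ⟶ Z), PreservesLimit (cospan f g) Φ := fun f g => by
    obtain ⟨P, a, b, h, h'⟩ := H f g
    exact preservesLimit_of_preserves_limit_cone h.isLimit
      ((isLimitMapConePullbackConeEquiv Φ h.w).symm h'.isLimit)
  exact ⟨fun {D} => preservesLimit_of_iso_diagram _ (diagramIsoCospan D).symm⟩

lemma CategoryTheory.IsPullback.comp_iso {A : Type u} [Category.{v} A] {P X Y Z X' Y' : A}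
    {a : P ⟶ X} {b : P ⟶ Y} {f : X ⟶ Z} {g : Y ⟶ Z} (h : IsPullback a b f g) (e : X' ≅ X)
    (e' : Y' ≅ Y) : IsPullback (a ≫ e.inv) (b ≫ e'.inv) (e.hom ≫ f) (e'.hom ≫ g) :=
  IsPullback.of_iso h (Iso.refl _) e.symm e'.symm (Iso.refl _) (by simp) (by simp)
    (by simp) (by simp)

lemma CategoryTheory.IsIso.of_existsUnique {A : Type u} [Category.{v} A] {X Y : A} (f : X ⟶ Y)
    (H : ∀ (W : A) (s : W ⟶ Y), ∃! t : W ⟶ X, t ≫ f = s) : IsIso f := by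
  obtain ⟨r, hr, -⟩ := H Y (𝟙 Y)
  exact ⟨r, (H X f).unique (by simp [hr]) (by simp), hr⟩

/-- Substituting this factorization makes the object maps agree on the nose, so that the dependent
hom-components can be compared without casts. -/
lemma Function.Surjective.exists_comp_eq {α β γ : Type*} {f : β → γ} (hf : Function.Surjective f)
    (g : α → γ) : ∃ h : α → β, g = fun a => f (h a) :=
  ⟨fun a => (hf (g a)).choose, funext fun a => (hf (g a)).choose_spec.symm⟩

namespace VGph

variable {A : Type u} [Category.{v} A]

/-! ### Morphisms and isomorphisms of graphs -/

section

variable {G H : VGph.{w} A}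

/-- The morphism of graphs with given components. -/
abbrev homMk (obj : G.ob → H.ob) (map : ∀ x y, G.hom x y ⟶ H.hom (obj x) (obj y)) : G ⟶ H :=
  Hom.mk obj map

lemma homMk_eq_iff {o : G.ob → H.ob} {m n : ∀ x y, G.hom x y ⟶ H.hom (o x) (o y)} :
    homMk o m = homMk o n ↔ ∀ x y, m x y = n x y := by
  constructor
  · intro h x y
    have := (Hom.mk.inj h).2
    rw [eq_of_heq this]
  · intro h
    have : m = n := by funext x y; exact h x y
    rw [this]

lemma exists_eq_homMk (f : G ⟶ H) : ∃ o m, f = homMk o m := ⟨f.obj, f.map, rfl⟩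

lemma obj_eq_of_eq {f g : G ⟶ H} (h : f = g) : Hom.obj f = Hom.obj g := by rw [h]

/-- A morphism which is bijective on objects and invertible on hom-objects is invertible. -/
lemma isIso_of_bijective (f : G ⟶ H) (h₁ : Function.Bijective (Hom.obj f))
    (h₂ : ∀ x y, IsIso (Hom.map f x y)) : IsIso f := by
  refine IsIso.of_existsUnique f fun W s => ?_
  obtain ⟨so, sm, rfl⟩ := exists_eq_homMk s
  obtain ⟨t, rfl⟩ := Function.Surjective.exists_comp_eq h₁.2 so
  refine ⟨homMk t fun x y => sm x y ≫ inv (Hom.map f _ _), ?_, ?_⟩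
  · exact homMk_eq_iff.2 fun x y => by simp
  · intro t' ht'
    obtain ⟨u, tm, rfl⟩ := exists_eq_homMk t'
    obtain rfl : t = u := by
      funext w
      exact h₁.1 (congrFun (obj_eq_of_eq ht') w).symm
    refine homMk_eq_iff.2 fun x y => ?_
    have := (homMk_eq_iff.1 ht') x y
    exact (IsIso.eq_comp_inv _).2 this

lemma bijective_of_isIso (f : G ⟶ H) [IsIso f] : Function.Bijective (Hom.obj f) :=
  ⟨Function.LeftInverse.injective (g := Hom.obj (inv f)) fun x =>
      congrFun (obj_eq_of_eq (IsIso.hom_inv_id f)) x,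
    Function.RightInverse.surjective (g := Hom.obj (inv f)) fun x =>
      congrFun (obj_eq_of_eq (IsIso.inv_hom_id f)) x⟩

lemma isIso_map_of_eq_id (f : G ⟶ G) (h : f = 𝟙 G) (x y : G.ob) : IsIso (Hom.map f x y) := by
  subst h
  exact inferInstanceAs (IsIso (𝟙 _))

/-- Two-out-of-six: the hom-components of `f`, `inv f`, `f` have both consecutive composites
invertible, so the middle component is split epi and mono, hence invertible, and so is the first.
This avoids comparing `inv f (f x)` with `x` by casts. -/
lemma isIso_map_of_isIso (f : G ⟶ H) [IsIso f] (x y : G.ob) : IsIso (Hom.map f x y) := by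
  have h₁ : IsIso (Hom.map f x y ≫ Hom.map (inv f) _ _) :=
    isIso_map_of_eq_id (f ≫ inv f) (by simp) x y
  have h₂ : IsIso (Hom.map (inv f) (Hom.obj f x) (Hom.obj f y) ≫ Hom.map f _ _) :=
    isIso_map_of_eq_id (inv f ≫ f) (by simp) _ _
  have : IsSplitEpi (Hom.map (inv f) (Hom.obj f x) (Hom.obj f y)) :=
    ⟨⟨⟨inv (Hom.map f x y ≫ Hom.map (inv f) _ _) ≫ Hom.map f x y, by simp⟩⟩⟩
  have : Mono (Hom.map (inv f) (Hom.obj f x) (Hom.obj f y)) :=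
    mono_of_mono _ (Hom.map f _ _)
  have : IsIso (Hom.map (inv f) (Hom.obj f x) (Hom.obj f y)) := isIso_of_mono_of_isSplitEpi _
  exact IsIso.of_isIso_comp_right _ (Hom.map (inv f) (Hom.obj f x) (Hom.obj f y))

end

/-! ### Pullbacks of graphs -/

section Pullback

/-- A square of graphs whose vertical maps are the identity on objects is a pullback if it is a
pullback on hom-objects. -/
lemma isPullback_of_id {S S' : Type w} {M N : S → S → A} {M' N' : S' → S' → A} {φ : S → S'}
    {t : ∀ x y, M x y ⟶ M' (φ x) (φ y)} {b : ∀ x y, N x y ⟶ N' (φ x) (φ y)}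
    {l : ∀ x y, M x y ⟶ N x y} {r : ∀ x y, M' x y ⟶ N' x y}
    (H : ∀ x y, IsPullback (t x y) (l x y) (r (φ x) (φ y)) (b x y)) :
    IsPullback (homMk (G := ⟨S, M⟩) (H := ⟨S', M'⟩) φ t) (homMk (H := ⟨S, N⟩) (fun x => x) l)
      (homMk (H := ⟨S', N'⟩) (fun x => x) r) (homMk φ b) := by
  refine .of_existsUnique (homMk_eq_iff.2 fun x y => (H x y).w) fun W s k hsk => ?_
  obtain ⟨so, sm, rfl⟩ := exists_eq_homMk s
  obtain ⟨ko, km, rfl⟩ := exists_eq_homMk k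
  obtain rfl : so = fun x => φ (ko x) := obj_eq_of_eq hsk
  have hsk := homMk_eq_iff.1 hsk
  refine ⟨homMk ko fun x y => (H _ _).lift (sm x y) (km x y) (hsk x y), ⟨?_, ?_⟩, ?_⟩
  · exact homMk_eq_iff.2 fun x y => (H _ _).lift_fst _ _ _
  · exact homMk_eq_iff.2 fun x y => (H _ _).lift_snd _ _ _
  · rintro m ⟨h₁, h₂⟩
    obtain ⟨mo, mm, rfl⟩ := exists_eq_homMk m
    obtain rfl : mo = ko := obj_eq_of_eq h₂
    refine homMk_eq_iff.2 fun x y => (H _ _).hom_ext ?_ ?_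
    · rw [(H _ _).lift_fst]; exact homMk_eq_iff.1 h₁ x y
    · rw [(H _ _).lift_snd]; exact homMk_eq_iff.1 h₂ x y

/-- A square of graphs which is a (standard) pullback on objects and a pullback on hom-objects is
a pullback. -/
lemma isPullback_of_sigma {K : Type w} {F E : K → Type w} {X : (Σ k, F k) → (Σ k, F k) → A}
    {Y : (Σ k, E k) → (Σ k, E k) → A} {Z : K → K → A}
    {P : (Σ k, F k × E k) → (Σ k, F k × E k) → A}
    {a : ∀ p q, P p q ⟶ X ⟨p.1, p.2.1⟩ ⟨q.1, q.2.1⟩}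
    {b : ∀ p q, P p q ⟶ Y ⟨p.1, p.2.2⟩ ⟨q.1, q.2.2⟩}
    {f : ∀ p q, X p q ⟶ Z p.1 q.1} {g : ∀ p q, Y p q ⟶ Z p.1 q.1}
    (H : ∀ p q, IsPullback (a p q) (b p q) (f _ _) (g _ _)) :
    IsPullback (homMk (G := ⟨_, P⟩) (H := ⟨_, X⟩) (fun p => ⟨p.1, p.2.1⟩) a)
      (homMk (H := ⟨_, Y⟩) (fun p => ⟨p.1, p.2.2⟩) b)
      (homMk (H := ⟨K, Z⟩) (fun p => p.1) f) (homMk (fun p => p.1) g) := by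
  refine .of_existsUnique (homMk_eq_iff.2 fun x y => (H x y).w) fun W s t hst => ?_
  obtain ⟨so, sm, rfl⟩ := exists_eq_homMk s
  obtain ⟨u, tm, rfl⟩ := exists_eq_homMk t
  obtain ⟨k, i, rfl⟩ : ∃ (k : W.ob → K) (i : ∀ x, F (k x)), so = fun x => ⟨k x, i x⟩ :=
    ⟨fun x => (so x).1, fun x => (so x).2, rfl⟩
  obtain ⟨k', j, rfl⟩ : ∃ (k : W.ob → K) (i : ∀ x, E (k x)), u = fun x => ⟨k x, i x⟩ :=
    ⟨fun x => (u x).1, fun x => (u x).2, rfl⟩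
  obtain rfl : k = k' := obj_eq_of_eq hst
  have hst := homMk_eq_iff.1 hst
  refine ⟨homMk (fun x => ⟨k x, i x, j x⟩)
    fun x y => (H ⟨k x, i x, j x⟩ ⟨k y, i y, j y⟩).lift (sm x y) (tm x y) (hst x y), ⟨?_, ?_⟩, ?_⟩
  · exact homMk_eq_iff.2 fun x y => (H ⟨k x, i x, j x⟩ ⟨k y, i y, j y⟩).lift_fst _ _ _
  · exact homMk_eq_iff.2 fun x y => (H ⟨k x, i x, j x⟩ ⟨k y, i y, j y⟩).lift_snd _ _ _
  · rintro m ⟨h₁, h₂⟩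
    obtain ⟨mo, mm, rfl⟩ := exists_eq_homMk m
    obtain ⟨k', i', j', rfl⟩ : ∃ (k : W.ob → K) (i : ∀ x, F (k x)) (j : ∀ x, E (k x)),
        mo = fun x => ⟨k x, i x, j x⟩ :=
      ⟨fun x => (mo x).1, fun x => (mo x).2.1, fun x => (mo x).2.2, rfl⟩
    have e₁ := obj_eq_of_eq h₁
    have e₂ := obj_eq_of_eq h₂
    obtain rfl : k' = k := funext fun x => congrArg Sigma.fst (congrFun e₁ x)
    obtain rfl : i' = i := funext fun x => eq_of_heq (Sigma.mk.inj (congrFun e₁ x)).2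
    obtain rfl : j' = j := funext fun x => eq_of_heq (Sigma.mk.inj (congrFun e₂ x)).2
    refine homMk_eq_iff.2 fun x y => (H ⟨_, i' x, j' x⟩ ⟨_, i' y, j' y⟩).hom_ext ?_ ?_
    · rw [IsPullback.lift_fst]; exact homMk_eq_iff.1 h₁ x y
    · rw [IsPullback.lift_snd]; exact homMk_eq_iff.1 h₂ x y

/-- Every graph over `Z` is isomorphic to one whose map to `Z` is a projection on objects. -/
lemma exists_sigma {X Z : VGph.{w} A} (f : X ⟶ Z) :
    ∃ (F : Z.ob → Type w) (X' : (Σ k, F k) → (Σ k, F k) → A) (f' : ∀ p q, X' p q ⟶ Z.hom p.1 q.1)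
      (e : X ≅ ⟨_, X'⟩), e.hom ≫ homMk (fun p => p.1) f' = f := by
  -- The objects of `X` are replaced by pairs of an object of `Z` and a point of the fibre over it.
  let X' : (Σ k, {x // Hom.obj f x = k}) → (Σ k, {x // Hom.obj f x = k}) → A :=
    fun p q => X.hom p.2.1 q.2.1
  let e : X ⟶ ⟨_, X'⟩ := homMk (fun x => ⟨Hom.obj f x, x, rfl⟩) fun x y => 𝟙 _
  have : IsIso e := isIso_of_bijective e
    ⟨fun x y h => by
      have h₁ : Hom.obj f x = Hom.obj f y := congrArg Sigma.fst h
      have h₂ : ∀ p q : Σ k, {x // Hom.obj f x = k}, p = q → p.2.1 = q.2.1 := by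
        rintro p _ rfl; rfl
      exact h₂ _ _ h, by rintro ⟨_, x, rfl⟩; exact ⟨x, rfl⟩⟩
    fun x y => inferInstanceAs (IsIso (𝟙 _))
  refine ⟨_, X', fun p q => Hom.map f _ _ ≫ eqToHom (by rw [p.2.2, q.2.2]), asIso e, ?_⟩
  exact homMk_eq_iff.2 fun x y => by simp [e]

instance hasPullbacks [HasPullbacks A] : HasPullbacks (VGph.{w} A) := by
  have : ∀ {X Y Z : VGph.{w} A} (f : X ⟶ Z) (g : Y ⟶ Z), HasPullback f g := fun f g => by
    obtain ⟨F, X', f', e, rfl⟩ := exists_sigma f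
    obtain ⟨E, Y', g', e', rfl⟩ := exists_sigma g
    have h := isPullback_of_sigma (X := X') (Y := Y') (f := f') (g := g')
      fun p q => IsPullback.of_hasPullback _ _
    exact (h.comp_iso e e').hasPullback
  exact hasPullbacks_of_hasLimit_cospan _

/-- A functor preserves pullbacks of graphs if it preserves the standard ones. -/
lemma preservesPullbacks_of_sigma [HasPullbacks A] {C : Type u₁} [Category.{v₁} C]
    (Φ : VGph.{w} A ⥤ C)
    (H : ∀ {K : Type w} {F E : K → Type w} {X : (Σ k, F k) → (Σ k, F k) → A}
      {Y : (Σ k, E k) → (Σ k, E k) → A} {Z : K → K → A}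
      {P : (Σ k, F k × E k) → (Σ k, F k × E k) → A}
      {a : ∀ p q, P p q ⟶ X ⟨p.1, p.2.1⟩ ⟨q.1, q.2.1⟩}
      {b : ∀ p q, P p q ⟶ Y ⟨p.1, p.2.2⟩ ⟨q.1, q.2.2⟩}
      {f : ∀ p q, X p q ⟶ Z p.1 q.1} {g : ∀ p q, Y p q ⟶ Z p.1 q.1}
      (_ : ∀ p q, IsPullback (a p q) (b p q) (f _ _) (g _ _)),
      IsPullback (Φ.map (homMk (G := ⟨_, P⟩) (H := ⟨_, X⟩) (fun p => ⟨p.1, p.2.1⟩) a))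
        (Φ.map (homMk (H := ⟨_, Y⟩) (fun p => ⟨p.1, p.2.2⟩) b))
        (Φ.map (homMk (H := ⟨K, Z⟩) (fun p => p.1) f)) (Φ.map (homMk (fun p => p.1) g))) :
    PreservesLimitsOfShape WalkingCospan Φ := by
  refine preservesPullbacks_of_exists Φ fun f g => ?_
  obtain ⟨F, X', f', e, rfl⟩ := exists_sigma f
  obtain ⟨E, Y', g', e', rfl⟩ := exists_sigma g
  have hP := fun (p q : Σ k, F k × E k) => IsPullback.of_hasPullback
    (f' ⟨p.1, p.2.1⟩ ⟨q.1, q.2.1⟩) (g' ⟨p.1, p.2.2⟩ ⟨q.1, q.2.2⟩)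
  have h := isPullback_of_sigma (X := X') (Y := Y') (f := f') (g := g') hP
  have h' := h.comp_iso e e'
  have h'' := (H hP).comp_iso (Φ.mapIso e) (Φ.mapIso e')
  simp only [Functor.mapIso_hom, Functor.mapIso_inv, ← Φ.map_comp] at h''
  exact ⟨_, _, _, h', h''⟩

end Pullback

end VGph

/-! ### Coproducts of graphs -/

lemma hasCoproducts_of_exists {A : Type u} [Category.{v} A]
    (H : ∀ {I : Type w} (X : I → A), ∃ (S : A) (ι : ∀ i, X i ⟶ S), IsCoprod X ι) :
    HasCoproducts.{w} A := fun I =>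
  { has_colimit := fun D => by
      obtain ⟨S, ι, h⟩ := H fun i => D.obj ⟨i⟩
      have : HasColimit (Discrete.functor (D.obj ∘ Discrete.mk)) := ⟨⟨_, h.isColimit⟩⟩
      exact hasColimit_of_iso (Discrete.natIsoFunctor (F := D)) }

/-- It suffices to check that coproducts are stable under pullback and disjoint for one choice of
coproducts and of pullbacks. -/
lemma HasVanKampenCoproducts.of_exists {A : Type u} [Category.{v} A]
    (H : ∀ {I : Type w} (X : I → A), ∃ (S : A) (ι : ∀ i, X i ⟶ S), IsCoprod X ι ∧
      (∀ {D : A} (g : D ⟶ S), ∃ (P : I → A) (p : ∀ i, P i ⟶ D) (q : ∀ i, P i ⟶ X i),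
        (∀ i, IsPullback (p i) (q i) g (ι i)) ∧ IsCoprod P p) ∧
      (∀ (Y : I → A) (f : ∀ i, Y i ⟶ X i), ∃ (T : A) (κ : ∀ i, Y i ⟶ T) (F : T ⟶ S),
        IsCoprod Y κ ∧ ∀ i, IsPullback (κ i) (f i) F (ι i))) :
    HasVanKampenCoproducts.{w} A where
  hasCoproducts := hasCoproducts_of_exists fun X =>
    let ⟨S, ι, h, _⟩ := H X
    ⟨S, ι, h⟩
  univ {I X S ι} hι {D g P p q} hP := by
    obtain ⟨S', ι', hι', H₁, -⟩ := H X
    have : IsIso (hι.desc ι') := hι.isIso_of_comp hι' _ fun i => by simp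
    obtain ⟨P', p', q', hP', hp'⟩ := H₁ (g ≫ hι.desc ι')
    have hP'' : ∀ i, IsPullback (p i) (q i) (g ≫ hι.desc ι') (ι' i) := fun i =>
      IsPullback.of_iso (hP i) (Iso.refl _) (Iso.refl _) (Iso.refl _) (asIso (hι.desc ι'))
        (by simp) (by simp) (by simp) (by simp)
    have := hp'.iso_comp fun i => (hP'' i).isoIsPullback _ _ (hP' i)
    simpa using this
  disj {I X Y S T ι κ} hι hκ f F hF i := by
    obtain ⟨S', ι', hι', -, H₂⟩ := H X
    obtain ⟨T', κ', F', hκ', h⟩ := H₂ Y f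
    have : IsIso (hι'.desc ι) := hι'.isIso_of_comp hι _ fun i => by simp
    have : IsIso (hκ'.desc κ) := hκ'.isIso_of_comp hκ _ fun i => by simp
    refine IsPullback.of_iso (h i) (Iso.refl _) (asIso (hκ'.desc κ)) (Iso.refl _)
      (asIso (hι'.desc ι)) (by simp) (by simp) ?_ (by simp)
    refine hκ'.hom_ext fun j => ?_
    simp only [asIso_hom, reassoc_of% (h j).w, IsCoprod.ι_desc, IsCoprod.ι_desc_assoc, hF]

lemma preservesCoproducts_of_exists {A : Type u} [Category.{v} A] {B : Type u₁}
    [Category.{v₁} B] (Φ : A ⥤ B) {I : Type w} (H : ∀ X : I → A, ∃ (S : A) (ι : ∀ i, X i ⟶ S),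
      IsCoprod X ι ∧ IsCoprod (fun i => Φ.obj (X i)) (fun i => Φ.map (ι i))) :
    PreservesColimitsOfShape (Discrete I) Φ := by
  refine ⟨fun {D} => ?_⟩
  obtain ⟨S, ι, h, h'⟩ := H (D.obj ∘ Discrete.mk)
  have : PreservesColimit (Discrete.functor (D.obj ∘ Discrete.mk)) Φ :=
    preservesColimit_of_preserves_colimit_cocone h.isColimit
      ((isColimitMapCoconeCofanMkEquiv Φ _ _).symm h'.isColimit)
  exact preservesColimit_of_iso_diagram _ (Discrete.natIsoFunctor (F := D)).symm

/-- If `U` is conservative and preserves pullbacks and coproducts, then `A` has well-behaved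
coproducts when `B` does. -/
lemma HasVanKampenCoproducts.of_functor {A : Type u} [Category.{v} A] {B : Type u₁}
    [Category.{v₁} B] (U : A ⥤ B) [HasPullbacks A] (hA : HasCoproducts.{w} A)
    [U.ReflectsIsomorphisms] [PreservesLimitsOfShape WalkingCospan U]
    [∀ I : Type w, PreservesColimitsOfShape (Discrete I) U] (hB : HasVanKampenCoproducts.{w} B) :
    HasVanKampenCoproducts.{w} A where
  hasCoproducts := hA
  univ {I X S ι} hι {D g P p q} hP := by
    have : HasColimitsOfShape (Discrete I) A := hA I
    -- A conservative functor reflects those colimits that exist in the source and that it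
    -- preserves, so both axioms can be tested in `B`.
    have : ReflectsColimitsOfShape (Discrete I) U :=
      reflectsColimitsOfShape_of_reflectsIsomorphisms
    exact .of_map U (hB.univ (hι.map U) fun i => (hP i).map U)
  disj {I X Y S T ι κ} hι hκ f F hF i := by
    have : ReflectsLimitsOfShape WalkingCospan U := reflectsLimitsOfShape_of_reflectsIsomorphisms
    exact IsPullback.of_map U (hF i) (hB.disj (hι.map U) (hκ.map U)
      (fun i => by rw [← U.map_comp, hF, U.map_comp]) i)

namespace VGph

variable {A : Type u} [Category.{v} A]

/-! ### Disjoint unions of graphs as block matrices -/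

section

variable {I : Type w} {S : I → Type w} {M : ∀ i, S i → S i → A}
  {K : (Σ i, S i) → (Σ i, S i) → A} (k : ∀ i x y, M i x y ⟶ K ⟨i, x⟩ ⟨i, y⟩)

/-- `K` is the hom-object matrix of the disjoint union of the graphs `(S i, M i)`. -/
structure IsDisjointUnion : Prop where
  isIso : ∀ i x y, IsIso (k i x y)
  isInitial : ∀ p q : Σ i, S i, p.1 ≠ q.1 → Nonempty (IsInitial (K p q))

variable {k}

/-- On a diagonal block the map is forced by inverting `k`; off the diagonal the entry is initial.
-/
lemma IsDisjointUnion.exists_desc (h : IsDisjointUnion k) {Z : (Σ i, S i) → (Σ i, S i) → A}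
    (f : ∀ i x y, M i x y ⟶ Z ⟨i, x⟩ ⟨i, y⟩) :
    ∃ g : ∀ p q, K p q ⟶ Z p q, ∀ i x y, k i x y ≫ g ⟨i, x⟩ ⟨i, y⟩ = f i x y := by
  -- Quantifying over all presentations of `p` and `q` as members of one block makes it possible to
  -- decide equality of the indices before any component of `f` is named.
  have key : ∀ p q, ∃ g : K p q ⟶ Z p q, ∀ i x y (hp : p = ⟨i, x⟩) (hq : q = ⟨i, y⟩),
      k i x y ≫ eqToHom (by rw [hp, hq]) ≫ g ≫ eqToHom (by rw [hp, hq]) = f i x y := by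
    rintro ⟨i, x⟩ ⟨j, y⟩
    by_cases hij : i = j
    · subst hij
      have := h.isIso i x y
      refine ⟨inv (k i x y) ≫ f i x y, ?_⟩
      rintro i' x' y' hp hq
      cases hp
      cases hq
      simp
    · refine ⟨(h.isInitial ⟨i, x⟩ ⟨j, y⟩ hij).some.to _, ?_⟩
      rintro i' x' y' hp hq
      cases hp
      cases hq
      exact absurd rfl hij
  choose g hg using key
  exact ⟨g, fun i x y => by simpa using hg _ _ i x y rfl rfl⟩

lemma IsDisjointUnion.hom_ext (h : IsDisjointUnion k) {Z : (Σ i, S i) → (Σ i, S i) → A}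
    {f g : ∀ p q, K p q ⟶ Z p q}
    (H : ∀ i x y, k i x y ≫ f ⟨i, x⟩ ⟨i, y⟩ = k i x y ≫ g ⟨i, x⟩ ⟨i, y⟩) (p q : Σ i, S i) :
    f p q = g p q := by
  obtain ⟨i, x⟩ := p
  obtain ⟨j, y⟩ := q
  by_cases hij : i = j
  · subst hij
    have := h.isIso i x y
    exact (cancel_epi (k i x y)).1 (H i x y)
  · exact (h.isInitial ⟨i, x⟩ ⟨j, y⟩ hij).some.hom_ext _ _

lemma IsDisjointUnion.isCoprod (h : IsDisjointUnion k) :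
    IsCoprod (fun i => (⟨S i, M i⟩ : VGph.{w} A))
      (fun i => homMk (H := ⟨_, K⟩) (fun x => ⟨i, x⟩) (k i)) := by
  intro W f
  obtain ⟨o, m, rfl⟩ : ∃ (o : ∀ i, S i → W.ob) (m : ∀ i x y, M i x y ⟶ W.hom (o i x) (o i y)),
      f = fun i => homMk (o i) (m i) := ⟨fun i => (f i).obj, fun i => (f i).map, rfl⟩
  obtain ⟨g, hg⟩ := h.exists_desc (Z := fun p q => W.hom (o p.1 p.2) (o q.1 q.2)) m
  refine ⟨homMk (fun p => o p.1 p.2) g, fun i => homMk_eq_iff.2 (hg i), fun g' hg' => ?_⟩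
  obtain ⟨o', g', rfl⟩ := exists_eq_homMk g'
  obtain rfl : o' = fun p => o p.1 p.2 :=
    funext fun p => congrFun (obj_eq_of_eq (hg' p.1)) p.2
  refine homMk_eq_iff.2 fun p q => h.hom_ext (fun i x y => ?_) p q
  exact (homMk_eq_iff.1 (hg' i) x y).trans (hg i x y).symm

lemma exists_isDisjointUnion [HasInitial A] (M : ∀ i, S i → S i → A) :
    ∃ (K : (Σ i, S i) → (Σ i, S i) → A) (k : ∀ i x y, M i x y ⟶ K ⟨i, x⟩ ⟨i, y⟩),
      IsDisjointUnion k := by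
  classical
  refine ⟨fun p q => if h : p.1 = q.1 then M q.1 (h ▸ p.2) q.2 else ⊥_ A,
    fun i x y => eqToHom (by simp), fun i x y => inferInstance, fun p q h => ?_⟩
  simp only [h, dif_neg, not_false_eq_true]
  exact ⟨initialIsInitial⟩

end

/-- Coproducts of graphs are stable under pullback and disjoint. -/
lemma hasVanKampenCoproducts (hA : HasVanKampenCoproducts.{w} A) :
    HasVanKampenCoproducts.{w} (VGph.{w} A) := by
  have := hA.hasCoproducts
  have : HasInitial A :=
    (isCoprod_sigma (A := A) fun i : PEmpty.{w + 1} => i.elim).isInitial.some.hasInitial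
  refine .of_exists fun {I} G => ?_
  obtain ⟨S, M, rfl⟩ : ∃ (S : I → Type w) (M : ∀ i, S i → S i → A), G = fun i => ⟨S i, M i⟩ :=
    ⟨fun i => (G i).ob, fun i => (G i).hom, rfl⟩
  obtain ⟨K, k, hk⟩ := exists_isDisjointUnion M
  have := hk.isIso
  refine ⟨_, _, hk.isCoprod, ?_, ?_⟩
  · intro D g
    obtain ⟨F, D', g', e, rfl⟩ := exists_sigma g
    -- The fibre over the `i`-th summand is the full subgraph of `D` on the objects lying over it.
    let P : I → VGph.{w} A := fun i =>
      ⟨Σ x : S i, F ⟨i, x⟩, fun p q => D' ⟨⟨i, p.1⟩, p.2⟩ ⟨⟨i, q.1⟩, q.2⟩⟩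
    let p : ∀ i, P i ⟶ ⟨_, D'⟩ := fun i => homMk (fun p => ⟨⟨i, p.1⟩, p.2⟩) fun _ _ => 𝟙 _
    let q : ∀ i, P i ⟶ ⟨S i, M i⟩ := fun i => homMk (fun p => p.1)
      fun x y => g' ⟨⟨i, x.1⟩, x.2⟩ ⟨⟨i, y.1⟩, y.2⟩ ≫ inv (k i x.1 y.1)
    have hpq : ∀ i, IsPullback (p i) (q i) (homMk (H := ⟨_, K⟩) (fun p => p.1) g')
        (homMk (H := ⟨_, K⟩) (fun x => ⟨i, x⟩) (k i)) := fun i => by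
      refine .of_existsUnique (homMk_eq_iff.2 fun x y => by simp [p, q]) fun W s t hst => ?_
      obtain ⟨so, sm, rfl⟩ := exists_eq_homMk s
      obtain ⟨u, tm, rfl⟩ := exists_eq_homMk t
      obtain ⟨a, b, rfl⟩ : ∃ (a : W.ob → Σ i, S i) (b : ∀ x, F (a x)), so = fun x => ⟨a x, b x⟩ :=
        ⟨fun x => (so x).1, fun x => (so x).2, rfl⟩
      obtain rfl : a = fun x => ⟨i, u x⟩ := obj_eq_of_eq hst
      have hst := homMk_eq_iff.1 hst
      refine ⟨homMk (fun x => ⟨u x, b x⟩) sm, ⟨?_, ?_⟩, ?_⟩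
      · exact homMk_eq_iff.2 fun x y => Category.comp_id _
      · refine homMk_eq_iff.2 fun x y => (Category.assoc _ _ _).symm.trans ?_
        exact (IsIso.comp_inv_eq _).2 (hst x y)
      · rintro m ⟨h₁, h₂⟩
        obtain ⟨mo, mm, rfl⟩ := exists_eq_homMk m
        obtain ⟨u', b', rfl⟩ : ∃ (u' : W.ob → S i) (b' : ∀ x, F ⟨i, u' x⟩),
          mo = fun x => ⟨u' x, b' x⟩ := ⟨fun x => (mo x).1, fun x => (mo x).2, rfl⟩
        obtain rfl : u' = u := obj_eq_of_eq h₂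
        obtain rfl : b' = b :=
          funext fun x => eq_of_heq (Sigma.mk.inj (congrFun (obj_eq_of_eq h₁) x)).2
        exact homMk_eq_iff.2 fun x y =>
          (Category.comp_id _).symm.trans (homMk_eq_iff.1 h₁ x y)
    -- A hom-object of `D` between objects over different summands maps to an initial object, hence
    -- is itself initial by strictness. So `D` is the disjoint union of the fibres, up to
    -- reassociating the indices.
    have hk' : IsDisjointUnion (S := fun i => Σ x : S i, F ⟨i, x⟩) (M := fun i => (P i).hom)
        (K := fun p q => D' ⟨⟨p.1, p.2.1⟩, p.2.2⟩ ⟨⟨q.1, q.2.1⟩, q.2.2⟩) (fun i x y => 𝟙 _) :=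
      ⟨fun i x y => inferInstance, fun p q h =>
        hA.isInitial_of_hom (hk.isInitial ⟨p.1, p.2.1⟩ ⟨q.1, q.2.1⟩ h).some (g' _ _)⟩
    let e' : (⟨Σ i, Σ x : S i, F ⟨i, x⟩, fun p q =>
        D' ⟨⟨p.1, p.2.1⟩, p.2.2⟩ ⟨⟨q.1, q.2.1⟩, q.2.2⟩⟩ : VGph.{w} A) ⟶
      ⟨_, D'⟩ := homMk (Equiv.sigmaAssoc fun (i : I) (x : S i) => F ⟨i, x⟩).symm fun _ _ => 𝟙 _
    have : IsIso e' := isIso_of_bijective _ (Equiv.bijective _)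
      fun x y => inferInstanceAs (IsIso (𝟙 _))
    have hc : IsCoprod P p := by
      convert hk'.isCoprod.comp_isIso e' using 2 with i
      exact homMk_eq_iff.2 fun x y => (Category.comp_id _).symm
    refine ⟨P, fun i => p i ≫ e.inv, q, fun i => ?_, hc.comp_isIso e.inv⟩
    exact IsPullback.of_iso (hpq i) (Iso.refl _) e.symm (Iso.refl _) (Iso.refl _)
      (by simp) (by simp) (by simp) (by simp)
  · intro Y f
    obtain ⟨S', M', rfl⟩ : ∃ (S : I → Type w) (M : ∀ i, S i → S i → A), Y = fun i => ⟨S i, M i⟩ :=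
      ⟨fun i => (Y i).ob, fun i => (Y i).hom, rfl⟩
    obtain ⟨o, m, rfl⟩ : ∃ (o : ∀ i, S' i → S i) (m : ∀ i x y, M' i x y ⟶ M i (o i x) (o i y)),
      f = fun i => homMk (o i) (m i) := ⟨fun i => (f i).obj, fun i => (f i).map, rfl⟩
    obtain ⟨K', k', hk'⟩ := exists_isDisjointUnion M'
    have := hk'.isIso
    obtain ⟨g, hg⟩ := hk'.exists_desc (Z := fun p q => K ⟨p.1, o p.1 p.2⟩ ⟨q.1, o q.1 q.2⟩)
      fun i x y => m i x y ≫ k i _ _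
    refine ⟨_, _, homMk (G := ⟨Σ i, S' i, K'⟩) (fun p => ⟨p.1, o p.1 p.2⟩) g, hk'.isCoprod,
      fun i => ?_⟩
    refine .of_existsUnique (homMk_eq_iff.2 (hg i)) fun W s t hst => ?_
    obtain ⟨so, sm, rfl⟩ := exists_eq_homMk s
    obtain ⟨u, tm, rfl⟩ := exists_eq_homMk t
    obtain ⟨a, b, rfl⟩ : ∃ (a : W.ob → I) (b : ∀ x, S' (a x)), so = fun x => ⟨a x, b x⟩ :=
      ⟨fun x => (so x).1, fun x => (so x).2, rfl⟩
    have e₁ := obj_eq_of_eq hst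
    obtain rfl : a = fun _ => i := funext fun x => congrArg Sigma.fst (congrFun e₁ x)
    obtain rfl : u = fun x => o i (b x) :=
      funext fun x => (eq_of_heq (Sigma.mk.inj (congrFun e₁ x)).2).symm
    have hst := homMk_eq_iff.1 hst
    -- All objects of the cone lie over the summand `i`, where `k'` is invertible, so the
    -- hom-components of the lift are forced.
    refine ⟨homMk b fun x y => sm x y ≫ inv (k' _ _ _), ⟨?_, ?_⟩, ?_⟩
    · exact homMk_eq_iff.2 fun x y => by simp
    · refine homMk_eq_iff.2 fun x y => ?_
      rw [← cancel_mono (k i _ _)]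
      refine Eq.trans ?_ (hst x y)
      simp [← hg]
    · rintro n ⟨h₁, h₂⟩
      obtain ⟨b', n, rfl⟩ := exists_eq_homMk n
      obtain rfl : b' = b :=
        funext fun x => eq_of_heq (Sigma.mk.inj (congrFun (obj_eq_of_eq h₁) x)).2
      exact homMk_eq_iff.2 fun x y => (IsIso.eq_comp_inv _).2 (homMk_eq_iff.1 h₁ x y)

end VGph

/-! ### Change of base for graphs -/

namespace VGph

variable {A : Type u} [Category.{v} A] {B : Type u₁} [Category.{v₁} B]

/-- An adjunction induces an adjunction between categories of graphs. -/
def mapAdjunction {F : B ⥤ A} {U : A ⥤ B} (adj : F ⊣ U) :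
    mapFunctor.{w} F ⊣ mapFunctor.{w} U :=
  Adjunction.mkOfUnitCounit
    { unit :=
        { app := fun G => homMk (fun x => x) fun x y => adj.unit.app (G.hom x y)
          naturality := fun _ _ f => homMk_eq_iff.2 fun x y => adj.unit.naturality (Hom.map f x y) }
      counit :=
        { app := fun G => homMk (fun x => x) fun x y => adj.counit.app (G.hom x y)
          naturality := fun _ _ f =>
            homMk_eq_iff.2 fun x y => adj.counit.naturality (Hom.map f x y) }
      left_triangle := by
        ext G
        refine homMk_eq_iff.2 fun x y => ?_
        refine (congrArg (F.map _ ≫ ·) (Category.id_comp _)).trans ?_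
        exact adj.left_triangle_components (G.hom x y)
      right_triangle := by
        ext G
        refine homMk_eq_iff.2 fun x y => ?_
        refine (congrArg (adj.unit.app _ ≫ ·) (Category.id_comp _)).trans ?_
        exact adj.right_triangle_components (G.hom x y) }

lemma preservesPullbacks_mapFunctor [HasPullbacks A] (F : A ⥤ B)
    [PreservesLimitsOfShape WalkingCospan F] :
    PreservesLimitsOfShape WalkingCospan (mapFunctor.{w} F) :=
  preservesPullbacks_of_sigma _ fun {_ _ _ X Y Z P a b f g} h =>
    isPullback_of_sigma (X := fun p q => F.obj (X p q)) (Y := fun p q => F.obj (Y p q))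
      (Z := fun p q => F.obj (Z p q)) (P := fun p q => F.obj (P p q))
      (a := fun p q => F.map (a p q)) (b := fun p q => F.map (b p q))
      (f := fun p q => F.map (f p q)) (g := fun p q => F.map (g p q)) fun p q => (h p q).map F

/-- A disjoint union only inserts initial objects off the diagonal, so it suffices that `F`
preserves the initial object. -/
lemma preservesCoproducts_mapFunctor (hA : HasCoproducts.{w} A) (F : A ⥤ B)
    [PreservesColimitsOfShape (Discrete PEmpty.{w + 1}) F] (I : Type w) :
    PreservesColimitsOfShape (Discrete I) (mapFunctor.{w} F) := by
  have : HasInitial A :=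
    (isCoprod_sigma (A := A) fun i : PEmpty.{w + 1} => i.elim).isInitial.some.hasInitial
  refine preservesCoproducts_of_exists _ fun G => ?_
  obtain ⟨S, M, rfl⟩ : ∃ (S : I → Type w) (M : ∀ i, S i → S i → A), G = fun i => ⟨S i, M i⟩ :=
    ⟨fun i => (G i).ob, fun i => (G i).hom, rfl⟩
  obtain ⟨K, k, hk⟩ := exists_isDisjointUnion M
  have := hk.isIso
  have hk' : IsDisjointUnion (M := fun i x y => F.obj (M i x y)) (K := fun p q => F.obj (K p q))
      (fun i x y => F.map (k i x y)) :=
    ⟨fun i x y => inferInstance, fun p q h =>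
      ((IsCoprod.of_isInitial (X := fun i : PEmpty.{w + 1} => i.elim) (ι := fun i => i.elim)
        (hk.isInitial p q h).some).map F).isInitial⟩
  exact ⟨_, _, hk.isCoprod, hk'.isCoprod⟩

end VGph

/-! ### Categories: limits and colimits -/

namespace VCat

variable {A : Type u} [Category.{v} A] [CartesianMonoidalCategory A]

/-! ### Functors and isomorphisms of enriched categories -/

section

variable {C D E : VCat.{w} A}

/-- The object map of a functor. -/
abbrev fobj (F : C ⟶ D) : C.ob → D.ob := EnrichedFunctor.obj F

/-- The map on hom-objects of a functor. -/
abbrev fmap (F : C ⟶ D) (x y : C.ob) :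
    (EnrichedCategory.Hom x y : A) ⟶ EnrichedCategory.Hom (fobj F x) (fobj F y) :=
  EnrichedFunctor.map F x y

lemma fmap_id (F : C ⟶ D) (x : C.ob) : eId A x ≫ fmap F x x = eId A (fobj F x) :=
  EnrichedFunctor.map_id F x

lemma fmap_comp (F : C ⟶ D) (x y z : C.ob) :
    eComp A x y z ≫ fmap F x z = (fmap F x y ⊗ₘ fmap F y z) ≫ eComp A _ _ _ :=
  EnrichedFunctor.map_comp F x y z

/-- The functor with given components. -/
abbrev homMk (obj : C.ob → D.ob)
    (map : ∀ x y, (EnrichedCategory.Hom x y : A) ⟶ EnrichedCategory.Hom (obj x) (obj y))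
    (map_id : ∀ x, eId A x ≫ map x x = eId A (obj x))
    (map_comp : ∀ x y z,
      eComp A x y z ≫ map x z = (map x y ⊗ₘ map y z) ≫ eComp A (obj x) (obj y) (obj z)) :
    C ⟶ D :=
  EnrichedFunctor.mk obj map map_id map_comp

instance forget_faithful : (forget.{w} A).Faithful where
  map_injective {C D F G} h := by
    obtain ⟨o, m, h₁, h₂⟩ := F
    obtain ⟨o', m', h₁', h₂'⟩ := G
    obtain ⟨rfl, h⟩ := VGph.Hom.mk.inj h
    obtain rfl := eq_of_heq h
    rfl

lemma exists_eq_homMk (F : C ⟶ D) : ∃ o m h₁ h₂, F = homMk o m h₁ h₂ :=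
  ⟨F.obj, F.map, F.map_id, F.map_comp, rfl⟩

lemma homMk_eq_iff {o m h₁ h₂ m' h₁' h₂'} :
    (homMk o m h₁ h₂ : C ⟶ D) = homMk o m' h₁' h₂' ↔ ∀ x y, m x y = m' x y :=
  ⟨fun h => (VGph.homMk_eq_iff (G := (forget A).obj C) (H := (forget A).obj D) (o := o)).1
      (congrArg (forget A).map h),
    fun h => (forget A).map_injective ((VGph.homMk_eq_iff (G := (forget A).obj C)
      (H := (forget A).obj D) (o := o)).2 h)⟩

lemma fobj_eq_of_eq {F G : C ⟶ D} (h : F = G) : fobj F = fobj G := by rw [h]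

/-- A functor which is bijective on objects and invertible on hom-objects is invertible. -/
lemma isIso_of_bijective (F : C ⟶ D) (h₁ : Function.Bijective (fobj F))
    (h₂ : ∀ x y, IsIso (fmap F x y)) : IsIso F := by
  refine IsIso.of_existsUnique F fun W s => ?_
  obtain ⟨so, sm, s₁, s₂, rfl⟩ := exists_eq_homMk s
  obtain ⟨t, rfl⟩ := Function.Surjective.exists_comp_eq h₁.2 so
  refine ⟨homMk t (fun x y => sm x y ≫ inv (fmap F _ _)) (fun x => ?_) (fun x y z => ?_), ?_, ?_⟩
  · rw [← cancel_mono (fmap F _ _), fmap_id]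
    simpa using s₁ x
  · rw [← cancel_mono (fmap F _ _), Category.assoc, Category.assoc, Category.assoc, fmap_comp]
    simpa using s₂ x y z
  · exact homMk_eq_iff.2 fun x y => by simp
  · intro t' ht'
    obtain ⟨u, tm, t₁, t₂, rfl⟩ := exists_eq_homMk t'
    obtain rfl : t = u := funext fun w => h₁.1 (congrFun (fobj_eq_of_eq ht') w).symm
    exact homMk_eq_iff.2 fun x y => (IsIso.eq_comp_inv _).2 (homMk_eq_iff.1 ht' x y)

instance forget_reflectsIsomorphisms : (forget.{w} A).ReflectsIsomorphisms where
  reflects F _ := isIso_of_bijective F (VGph.bijective_of_isIso ((forget A).map F))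
    fun x y => VGph.isIso_map_of_isIso ((forget A).map F) x y

end

/-! ### Equalizers of enriched functors -/

section Equalizers

/-- The identification of hom-objects along equalities of objects. -/
def castHom {C : VCat.{w} A} {x x' y y' : C.ob} (hx : x = x') (hy : y = y') :
    (EnrichedCategory.Hom x y : A) ⟶ EnrichedCategory.Hom x' y' :=
  eqToHom (by rw [hx, hy])

@[simp]
lemma castHom_rfl {C : VCat.{w} A} (x y : C.ob) :
    castHom (rfl : x = x) (rfl : y = y) = 𝟙 _ := rfl

lemma eId_castHom {C : VCat.{w} A} {x x' : C.ob} (hx : x = x') :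
    eId A x ≫ castHom hx hx = eId A x' := by
  subst hx; simp

lemma eComp_castHom {C : VCat.{w} A} {x x' y y' z z' : C.ob} (hx : x = x') (hy : y = y')
    (hz : z = z') :
    eComp A x y z ≫ castHom hx hz = (castHom hx hy ⊗ₘ castHom hy hz) ≫ eComp A x' y' z' := by
  subst hx hy hz; simp

lemma fmap_castHom_of_eq {C D : VCat.{w} A} {F G : C ⟶ D} (h : F = G) (x y : C.ob) :
    fmap F x y ≫ castHom (congrFun (fobj_eq_of_eq h) x) (congrFun (fobj_eq_of_eq h) y) =
      fmap G x y := by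
  subst h; exact Category.comp_id _

variable [HasEqualizers A] {C D : VCat.{w} A} (F G : C ⟶ D)

/-- The hom-objects of the equalizer of two functors. -/
noncomputable abbrev eqHom (x y : {x : C.ob // fobj F x = fobj G x}) : A :=
  equalizer (fmap F x.1 y.1 ≫ castHom x.2 y.2) (fmap G x.1 y.1)

/-- Composition in the equalizer of two functors. -/
noncomputable def eqComp (x y z : {x : C.ob // fobj F x = fobj G x}) :
    eqHom F G x y ⊗ eqHom F G y z ⟶ eqHom F G x z :=
  equalizer.lift ((equalizer.ι _ _ ⊗ₘ equalizer.ι _ _) ≫ eComp A x.1 y.1 z.1) (by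
    simp only [Category.assoc, fmap_comp, reassoc_of% (fmap_comp F), eComp_castHom x.2 y.2 z.2,
      tensorHom_comp_tensorHom_assoc, equalizer.condition])

/-- Identities in the equalizer of two functors. -/
noncomputable def eqId (x : {x : C.ob // fobj F x = fobj G x}) : 𝟙_ A ⟶ eqHom F G x x :=
  equalizer.lift (eId A x.1) (by rw [reassoc_of% (fmap_id F), fmap_id, eId_castHom])

@[simp]
lemma eqComp_ι (x y z : {x : C.ob // fobj F x = fobj G x}) :
    eqComp F G x y z ≫ equalizer.ι _ _ =
      (equalizer.ι _ _ ⊗ₘ equalizer.ι _ _) ≫ eComp A x.1 y.1 z.1 :=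
  equalizer.lift_ι _ _

@[simp]
lemma eqId_ι (x : {x : C.ob // fobj F x = fobj G x}) :
    eqId F G x ≫ equalizer.ι _ _ = eId A x.1 :=
  equalizer.lift_ι _ _

/-- The equalizer of two functors. -/
noncomputable def eqCat : VCat.{w} A where
  ob := {x : C.ob // fobj F x = fobj G x}
  str :=
    { Hom := eqHom F G
      id := eqId F G
      comp := eqComp F G
      id_comp := fun x y => by
        rw [← cancel_mono (equalizer.ι _ _)]
        simp only [Category.assoc, eqComp_ι, whiskerRight_comp_tensorHom_assoc, eqId_ι]
        simp [tensorHom_def']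
      comp_id := fun x y => by
        rw [← cancel_mono (equalizer.ι _ _)]
        simp only [Category.assoc, eqComp_ι, whiskerLeft_comp_tensorHom_assoc, eqId_ι]
        simp [MonoidalCategory.tensorHom_def]
      assoc := fun x y z t => by
        rw [← cancel_mono (equalizer.ι _ _)]
        have := ((equalizer.ι (fmap F x.1 y.1 ≫ castHom x.2 y.2) (fmap G x.1 y.1)) ⊗ₘ
          (equalizer.ι (fmap F y.1 z.1 ≫ castHom y.2 z.2) (fmap G y.1 z.1)) ⊗ₘ
          (equalizer.ι (fmap F z.1 t.1 ≫ castHom z.2 t.2) (fmap G z.1 t.1))) ≫=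
          e_assoc A x.1 y.1 z.1 t.1
        simp only [Category.assoc, eqComp_ι, whiskerRight_comp_tensorHom_assoc,
          whiskerLeft_comp_tensorHom_assoc]
        rw [associator_inv_naturality_assoc, tensorHom_comp_whiskerRight_assoc,
          tensorHom_comp_whiskerLeft_assoc] at this
        exact this }

/-- The inclusion of the equalizer of two functors. -/
noncomputable def eqι : eqCat F G ⟶ C :=
  homMk (C := eqCat F G) Subtype.val (fun _ _ => equalizer.ι _ _) (fun x => eqId_ι F G x)
    (fun x y z => eqComp_ι F G x y z)

lemma eqι_condition : eqι F G ≫ F = eqι F G ≫ G :=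
  EnrichedFunctor.ext A (fun x => x.2) fun _ _ =>
    (Category.assoc _ _ _).trans (equalizer.condition _ _)

/-- The equalizer of two functors is an equalizer. -/
noncomputable def eqIsLimit : IsLimit (Fork.ofι (eqι F G) (eqι_condition F G)) :=
  Fork.IsLimit.mk _
    (fun s => homMk (D := eqCat F G)
      (fun x => ⟨fobj s.ι x, congrFun (fobj_eq_of_eq s.condition) x⟩)
      (fun x y => equalizer.lift (fmap s.ι x y)
        ((Category.assoc _ _ _).symm.trans (fmap_castHom_of_eq s.condition x y)))
      (fun x => equalizer.hom_ext ((Category.assoc _ _ _).trans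
        ((congrArg (_ ≫ ·) (equalizer.lift_ι _ _)).trans
          ((fmap_id s.ι x).trans
            (eqId_ι F G ⟨fobj s.ι x, congrFun (fobj_eq_of_eq s.condition) x⟩).symm))))
      (fun x y z => equalizer.hom_ext (by
        refine (Category.assoc _ _ _).trans ((congrArg (_ ≫ ·) (equalizer.lift_ι _ _)).trans
          ((fmap_comp s.ι x y z).trans ?_))
        refine Eq.trans ?_ (Category.assoc _ _ _).symm
        refine Eq.trans ?_ (congrArg (fun k => (equalizer.lift (fmap s.ι x y) _ ⊗ₘ
          equalizer.lift (fmap s.ι y z) _) ≫ k) (eqComp_ι F G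
            ⟨fobj s.ι x, congrFun (fobj_eq_of_eq s.condition) x⟩
            ⟨fobj s.ι y, congrFun (fobj_eq_of_eq s.condition) y⟩
            ⟨fobj s.ι z, congrFun (fobj_eq_of_eq s.condition) z⟩)).symm
        rw [tensorHom_comp_tensorHom_assoc, equalizer.lift_ι, equalizer.lift_ι])))
    (fun s => homMk_eq_iff.2 fun x y => equalizer.lift_ι _ _)
    (fun s m hm => by
      obtain ⟨o, m, h₁, h₂, rfl⟩ := exists_eq_homMk m
      obtain rfl : o = fun x => ⟨fobj s.ι x, congrFun (fobj_eq_of_eq s.condition) x⟩ :=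
        funext fun x => Subtype.ext (congrFun (fobj_eq_of_eq hm) x)
      refine homMk_eq_iff.2 fun x y => equalizer.hom_ext ?_
      rw [equalizer.lift_ι]
      exact homMk_eq_iff.1 hm x y)

instance hasEqualizers : HasEqualizers (VCat.{w} A) :=
  have : ∀ {C D : VCat.{w} A} {F G : C ⟶ D}, HasLimit (parallelPair F G) :=
    ⟨⟨_, eqIsLimit _ _⟩⟩
  hasEqualizers_of_hasLimit_parallelPair _

end Equalizers

end VCat

/-! ### Coproducts of categories -/

namespace VGph.IsDisjointUnion

variable {A : Type u} [Category.{v} A] {I : Type w} {S : I → Type w} {M : ∀ i, S i → S i → A}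
  {K : (Σ i, S i) → (Σ i, S i) → A} {k : ∀ i x y, M i x y ⟶ K ⟨i, x⟩ ⟨i, y⟩}

variable [CartesianMonoidalCategory A] (h : IsDisjointUnion k)
  (hA : HasVanKampenCoproducts.{w} A)

include h hA

/-- One of the two factors is off-diagonal, hence initial, and the product projects to it;
strictness concludes. Composition in a disjoint union therefore only has to be specified inside each
block. -/
lemma isInitial_tensor (p q r : Σ i, S i) (hpqr : ¬(p.1 = q.1 ∧ q.1 = r.1)) :
    Nonempty (IsInitial (K p q ⊗ K q r)) := by
  by_cases hpq : p.1 = q.1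
  · exact hA.isInitial_of_hom (h.isInitial q r fun hqr => hpqr ⟨hpq, hqr⟩).some (snd _ _)
  · exact hA.isInitial_of_hom (h.isInitial p q hpq).some (fst _ _)

lemma exists_desc_tensor {Z : (Σ i, S i) → (Σ i, S i) → (Σ i, S i) → A}
    (f : ∀ i x y z, M i x y ⊗ M i y z ⟶ Z ⟨i, x⟩ ⟨i, y⟩ ⟨i, z⟩) :
    ∃ g : ∀ p q r, K p q ⊗ K q r ⟶ Z p q r,
      ∀ i x y z, (k i x y ⊗ₘ k i y z) ≫ g ⟨i, x⟩ ⟨i, y⟩ ⟨i, z⟩ = f i x y z := by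
  have key : ∀ p q r, ∃ g : K p q ⊗ K q r ⟶ Z p q r,
      ∀ i x y z (hp : p = ⟨i, x⟩) (hq : q = ⟨i, y⟩) (hr : r = ⟨i, z⟩),
      (k i x y ⊗ₘ k i y z) ≫ eqToHom (by rw [hp, hq, hr]) ≫ g ≫ eqToHom (by rw [hp, hq, hr]) =
        f i x y z := by
    rintro ⟨i, x⟩ ⟨i', y⟩ ⟨i'', z⟩
    by_cases hi : i = i' ∧ i' = i''
    · obtain ⟨rfl, rfl⟩ := hi
      have := h.isIso i
      refine ⟨inv (k i x y ⊗ₘ k i y z) ≫ f i x y z, ?_⟩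
      rintro i x y z hp hq hr
      cases hp
      cases hq
      cases hr
      simp
    · refine ⟨(h.isInitial_tensor hA ⟨i, x⟩ ⟨i', y⟩ ⟨i'', z⟩ hi).some.to _, ?_⟩
      rintro i x y z hp hq hr
      cases hp
      cases hq
      cases hr
      exact absurd ⟨rfl, rfl⟩ hi
  choose g hg using key
  exact ⟨g, fun i x y z => by simpa using hg _ _ _ i x y z rfl rfl rfl⟩

lemma hom_ext_tensor {Z : (Σ i, S i) → (Σ i, S i) → (Σ i, S i) → A}
    {f g : ∀ p q r, K p q ⊗ K q r ⟶ Z p q r}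
    (H : ∀ i x y z, (k i x y ⊗ₘ k i y z) ≫ f ⟨i, x⟩ ⟨i, y⟩ ⟨i, z⟩ =
      (k i x y ⊗ₘ k i y z) ≫ g ⟨i, x⟩ ⟨i, y⟩ ⟨i, z⟩) (p q r : Σ i, S i) :
    f p q r = g p q r := by
  obtain ⟨i, x⟩ := p
  obtain ⟨i', y⟩ := q
  obtain ⟨i'', z⟩ := r
  by_cases hi : i = i' ∧ i' = i''
  · obtain ⟨rfl, rfl⟩ := hi
    have := h.isIso i
    exact (cancel_epi (k i x y ⊗ₘ k i y z)).1 (H i x y z)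
  · exact (h.isInitial_tensor hA ⟨i, x⟩ ⟨i', y⟩ ⟨i'', z⟩ hi).some.hom_ext _ _

lemma hom_ext_tensor_tensor {Z : (Σ i, S i) → (Σ i, S i) → (Σ i, S i) → (Σ i, S i) → A}
    {f g : ∀ p q r s, K p q ⊗ K q r ⊗ K r s ⟶ Z p q r s}
    (H : ∀ i x y z t, (k i x y ⊗ₘ k i y z ⊗ₘ k i z t) ≫ f ⟨i, x⟩ ⟨i, y⟩ ⟨i, z⟩ ⟨i, t⟩ =
      (k i x y ⊗ₘ k i y z ⊗ₘ k i z t) ≫ g ⟨i, x⟩ ⟨i, y⟩ ⟨i, z⟩ ⟨i, t⟩) (p q r s : Σ i, S i) :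
    f p q r s = g p q r s := by
  obtain ⟨i, x⟩ := p
  obtain ⟨i', y⟩ := q
  obtain ⟨i'', z⟩ := r
  obtain ⟨i''', t⟩ := s
  by_cases hi : i = i'
  · subst hi
    by_cases hi : i = i'' ∧ i'' = i'''
    · obtain ⟨rfl, rfl⟩ := hi
      have := h.isIso i
      exact (cancel_epi (k i x y ⊗ₘ k i y z ⊗ₘ k i z t)).1 (H i x y z t)
    · exact (hA.isInitial_of_hom (h.isInitial_tensor hA ⟨i, y⟩ ⟨i'', z⟩ ⟨i''', t⟩ hi).some
        (snd _ _)).some.hom_ext _ _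
  · exact (hA.isInitial_of_hom (h.isInitial ⟨i, x⟩ ⟨i', y⟩ hi).some
        (fst _ _)).some.hom_ext _ _

end VGph.IsDisjointUnion

namespace VCat

variable {A : Type u} [Category.{v} A] [CartesianMonoidalCategory A]

/-- Coproducts of categories exist and are computed on the underlying graphs. -/
lemma exists_isCoprod (hA : HasVanKampenCoproducts.{w} A) {I : Type w} (C : I → VCat.{w} A) :
    ∃ (D : VCat.{w} A) (ι : ∀ i, C i ⟶ D), IsCoprod C ι ∧
      IsCoprod (fun i => (forget A).obj (C i)) (fun i => (forget A).map (ι i)) := by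
  have := hA.hasCoproducts
  have : HasInitial A :=
    (isCoprod_sigma (A := A) fun i : PEmpty.{w + 1} => i.elim).isInitial.some.hasInitial
  obtain ⟨K, k, hk⟩ := VGph.exists_isDisjointUnion (S := fun i => (C i).ob)
    fun i x y => (EnrichedCategory.Hom x y : A)
  -- Composition is that of `C i` on each block and the unique map from an initial object elsewhere;
  -- the axioms then only need checking on blocks.
  obtain ⟨c, hc⟩ := hk.exists_desc_tensor hA (Z := fun p _ r => K p r)
    fun i x y z => eComp A x y z ≫ k i x z
  let D : VCat.{w} A :=
    { ob := Σ i, (C i).ob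
      str :=
        { Hom := K
          id := fun p => eId A p.2 ≫ k p.1 p.2 p.2
          comp := c
          id_comp := hk.hom_ext (f := fun p q =>
              (λ_ _).inv ≫ (eId A p.2 ≫ k p.1 p.2 p.2) ▷ _ ≫ c p p q) fun i x y => by
            have h : ((eId A x ≫ k i x x) ⊗ₘ k i x y) = eId A x ▷ _ ≫ (k i x x ⊗ₘ k i x y) := by
              rw [whiskerRight_comp_tensorHom]
            rw [leftUnitor_inv_naturality_assoc, ← tensorHom_def'_assoc, h, Category.assoc, hc,
              e_id_comp_assoc, Category.comp_id]
          comp_id := hk.hom_ext (f := fun p q =>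
              (ρ_ _).inv ≫ _ ◁ (eId A q.2 ≫ k q.1 q.2 q.2) ≫ c p q q) fun i x y => by
            have h : (k i x y ⊗ₘ (eId A y ≫ k i y y)) = _ ◁ eId A y ≫ (k i x y ⊗ₘ k i y y) := by
              rw [whiskerLeft_comp_tensorHom]
            rw [rightUnitor_inv_naturality_assoc, ← MonoidalCategory.tensorHom_def_assoc, h,
              Category.assoc, hc, e_comp_id_assoc, Category.comp_id]
          assoc := hk.hom_ext_tensor_tensor hA (f := fun p q r s =>
              (α_ _ _ _).inv ≫ c p q r ▷ _ ≫ c p r s) fun i x y z t => by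
            rw [associator_inv_naturality_assoc, tensorHom_comp_whiskerRight_assoc,
              tensorHom_comp_whiskerLeft_assoc, hc, hc]
            have h₁ : (eComp A x y z ≫ k i x z ⊗ₘ k i z t) =
              eComp A x y z ▷ _ ≫ (k i x z ⊗ₘ k i z t) := by
                rw [whiskerRight_comp_tensorHom]
            have h₂ : (k i x y ⊗ₘ eComp A y z t ≫ k i y t) =
              _ ◁ eComp A y z t ≫ (k i x y ⊗ₘ k i y t) := by
                rw [whiskerLeft_comp_tensorHom]
            rw [h₁, h₂, Category.assoc, Category.assoc, hc, hc, e_assoc_assoc] } }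
  refine ⟨D, fun i => homMk (D := D) (fun x => ⟨i, x⟩) (k i) (fun _ => rfl)
    (fun x y z => (hc i x y z).symm), fun W f => ?_, hk.isCoprod⟩
  choose o m h₁ h₂ hf using fun i => exists_eq_homMk (f i)
  obtain rfl := funext hf
  obtain ⟨g, hg⟩ := hk.exists_desc
    (Z := fun p q => (EnrichedCategory.Hom (o p.1 p.2) (o q.1 q.2) : A)) m
  refine ⟨homMk (C := D) (fun p => o p.1 p.2) g (fun p => ?_) ?_, fun i => ?_, fun g' hg' => ?_⟩
  · exact (Category.assoc _ _ _).trans ((congrArg (_ ≫ ·) (hg _ _ _)).trans (h₁ _ _))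
  · refine hk.hom_ext_tensor hA (f := fun p q r => c p q r ≫ g p r)
      (g := fun p q r => (g p q ⊗ₘ g q r) ≫ eComp A _ _ _) fun i x y z => ?_
    simp only [reassoc_of% hc, hg, h₂, tensorHom_comp_tensorHom_assoc]
  · exact homMk_eq_iff.2 (hg i)
  · refine (forget A).map_injective ((hk.isCoprod (k := k)).hom_ext fun i => ?_)
    exact (congrArg (forget A).map (hg' i)).trans
      ((VGph.homMk_eq_iff (G := (forget A).obj (C i)) (H := (forget A).obj W)
        (o := o i)).2 fun x y => (hg i x y).symm)

lemma hasCoproducts (hA : HasVanKampenCoproducts.{w} A) : HasCoproducts.{w} (VCat.{w} A) :=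
  hasCoproducts_of_exists fun C =>
    let ⟨D, ι, h, _⟩ := exists_isCoprod hA C
    ⟨D, ι, h⟩

lemma preservesCoproducts_forget (hA : HasVanKampenCoproducts.{w} A) (I : Type w) :
    PreservesColimitsOfShape (Discrete I) (forget.{w} A) :=
  preservesCoproducts_of_exists _ fun C => exists_isCoprod hA C

end VCat

/-! ### Matrices and the free category on a graph -/

namespace VMat

variable {A : Type u} [Category.{v} A] [CartesianMonoidalCategory A] [HasCoproducts.{w} A]
  {S : Type w}

/-- The unit matrix. -/
noncomputable def one (x z : S) : A := ∐ fun _ : ULift.{w} (PLift (x = z)) => 𝟙_ A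

/-- The product of two matrices. -/
noncomputable def mul (M N : S → S → A) (x z : S) : A := ∐ fun y => M x y ⊗ N y z

/-- The powers of a matrix. -/
noncomputable def pow (M : S → S → A) : ℕ → S → S → A
  | 0 => one
  | n + 1 => mul (pow M n) M

/-- The sum of all powers of a matrix. -/
noncomputable def star (M : S → S → A) (x z : S) : A := ∐ fun n : ULift.{w} ℕ => pow M n.down x z

/-- The inclusion of a summand of the unit matrix. -/
noncomputable def oneι {x z : S} (h : x = z) : 𝟙_ A ⟶ one x z :=
  Limits.Sigma.ι (fun _ : ULift.{w} (PLift (x = z)) => 𝟙_ A) ⟨⟨h⟩⟩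

/-- The inclusion of a summand of a product of matrices. -/
noncomputable def mulι (M N : S → S → A) (x y z : S) : M x y ⊗ N y z ⟶ mul M N x z :=
  Limits.Sigma.ι (fun y => M x y ⊗ N y z) y

/-- The inclusion of a power of a matrix. -/
noncomputable def starι (M : S → S → A) (n : ℕ) (x z : S) : pow M n x z ⟶ star M x z :=
  Limits.Sigma.ι (fun n : ULift.{w} ℕ => pow M n.down x z) ⟨n⟩

lemma isCoprod_one (x z : S) :
    IsCoprod (fun _ : ULift.{w} (PLift (x = z)) => 𝟙_ A) fun h => oneι h.down.down :=
  isCoprod_sigma _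

lemma isCoprod_mul (M N : S → S → A) (x z : S) :
    IsCoprod (fun y => M x y ⊗ N y z) fun y => mulι M N x y z :=
  isCoprod_sigma _

lemma isCoprod_star (M : S → S → A) (x z : S) :
    IsCoprod (fun n : ULift.{w} ℕ => pow M n.down x z) fun n => starι M n.down x z :=
  isCoprod_sigma _

/-- The inclusion of a summand of the zeroth power of a matrix. -/
noncomputable def powZeroι (M : S → S → A) {x z : S} (h : x = z) : 𝟙_ A ⟶ pow M 0 x z := oneι h

/-- The inclusion of a summand of a successor power of a matrix. -/
noncomputable def powSuccι (M : S → S → A) (n : ℕ) (x y z : S) :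
    pow M n x y ⊗ M y z ⟶ pow M (n + 1) x z :=
  mulι (pow M n) M x y z

lemma isCoprod_pow_zero (M : S → S → A) (x z : S) :
    IsCoprod (fun _ : ULift.{w} (PLift (x = z)) => 𝟙_ A) fun h => powZeroι M h.down.down :=
  isCoprod_one x z

lemma isCoprod_pow_succ (M : S → S → A) (n : ℕ) (x z : S) :
    IsCoprod (fun y => pow M n x y ⊗ M y z) fun y => powSuccι M n x y z :=
  isCoprod_mul (pow M n) M x z

variable (hA : HasVanKampenCoproducts.{w} A) (M : S → S → A)

/-- The empty path. -/
noncomputable def starId (x : S) : 𝟙_ A ⟶ star M x x := powZeroι M rfl ≫ starι M 0 x x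

/-- Appending an edge to a path. -/
noncomputable def starStep (x y z : S) : star M x y ⊗ M y z ⟶ star M x z :=
  (hA.tensorRight (M y z) (isCoprod_star M x y)).desc fun n =>
    powSuccι M n.down x y z ≫ starι M (n.down + 1) x z

@[simp]
lemma starι_starStep (n : ℕ) (x y z : S) :
    starι M n x y ▷ M y z ≫ starStep hA M x y z =
      powSuccι M n x y z ≫ starι M (n + 1) x z :=
  (hA.tensorRight (M y z) (isCoprod_star M x y)).ι_desc _ ⟨n⟩

@[simp]
lemma starι_starStep_assoc (n : ℕ) (x y z : S) {Z : A} (k : star M x z ⟶ Z) :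
    starι M n x y ▷ M y z ≫ starStep hA M x y z ≫ k =
      powSuccι M n x y z ≫ starι M (n + 1) x z ≫ k := by
  rw [← Category.assoc, starι_starStep, Category.assoc]

/-! ### Recursion and induction on paths, with a parameter object -/

section Fold

variable {M} {X : A} {y : S} {Z : S → A}

/-- Maps out of `X ⊗ star M y z` are determined by their behaviour on the empty path and their
compatibility with appending an edge. -/
lemma hom_ext_tensor_star (act : ∀ w z, Z w ⊗ M w z ⟶ Z z) {f g : ∀ z, X ⊗ star M y z ⟶ Z z}
    (h₀ : X ◁ starId M y ≫ f y = X ◁ starId M y ≫ g y)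
    (hf : ∀ w z, X ◁ starStep hA M y w z ≫ f z = (α_ _ _ _).inv ≫ f w ▷ M w z ≫ act w z)
    (hg : ∀ w z, X ◁ starStep hA M y w z ≫ g z = (α_ _ _ _).inv ≫ g w ▷ M w z ≫ act w z)
    (z : S) : f z = g z := by
  -- Induction on the path length. Tensoring with `X` keeps each power a coproduct, and a path of
  -- length n + 1 is a path of length n with an edge appended.
  have key : ∀ n z, X ◁ starι M n y z ≫ f z = X ◁ starι M n y z ≫ g z := by
    intro n
    induction n with
    | zero =>
      intro z
      refine (hA.tensorLeft X (isCoprod_pow_zero M y z)).hom_ext ?_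
      rintro ⟨⟨rfl⟩⟩
      simpa [starId] using h₀
    | succ n ih =>
      intro z
      refine (hA.tensorLeft X (isCoprod_pow_succ M n y z)).hom_ext fun w => ?_
      have h : ∀ k : ∀ z, X ⊗ star M y z ⟶ Z z,
          (X ◁ starStep hA M y w z ≫ k z = (α_ _ _ _).inv ≫ k w ▷ M w z ≫ act w z) →
          X ◁ powSuccι M n y w z ≫ X ◁ starι M (n + 1) y z ≫ k z =
            (α_ _ _ _).inv ≫ (X ◁ starι M n y w ≫ k w) ▷ M w z ≫ act w z := fun k hk => by
        rw [← whiskerLeft_comp_assoc, ← starι_starStep hA, whiskerLeft_comp_assoc, hk]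
        simp
      rw [h f (hf w z), h g (hg w z), ih]
  exact (hA.tensorLeft X (isCoprod_star M y z)).hom_ext fun n => key n.down z

/-- The case of a trivial parameter. The general parameter is there because `A` is not assumed
closed: concatenation is defined by recursion on its second argument and cannot be curried. -/
lemma hom_ext_star (act : ∀ w z, Z w ⊗ M w z ⟶ Z z) {f g : ∀ z, star M y z ⟶ Z z}
    (h₀ : starId M y ≫ f y = starId M y ≫ g y)
    (hf : ∀ w z, starStep hA M y w z ≫ f z = f w ▷ M w z ≫ act w z)
    (hg : ∀ w z, starStep hA M y w z ≫ g z = g w ▷ M w z ≫ act w z)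
    (z : S) : f z = g z := by
  have := hom_ext_tensor_star hA (X := 𝟙_ A) act (f := fun z => (λ_ _).hom ≫ f z)
    (g := fun z => (λ_ _).hom ≫ g z) (by simp [h₀]) (fun w z => by simp [hf])
    (fun w z => by simp [hg]) z
  exact (cancel_epi _).1 this

/-- Auxiliary definition for `fold`. -/
noncomputable def foldPow (a : X ⟶ Z y) (act : ∀ w z, Z w ⊗ M w z ⟶ Z z) :
    ∀ (n : ℕ) (z : S), X ⊗ pow M n y z ⟶ Z z
  | 0, z => (hA.tensorLeft X (isCoprod_pow_zero M y z)).desc fun h =>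
      (ρ_ X).hom ≫ a ≫ eqToHom (by rw [h.down.down])
  | n + 1, z => (hA.tensorLeft X (isCoprod_pow_succ M n y z)).desc fun w =>
      (α_ _ _ _).inv ≫ foldPow a act n w ▷ M w z ≫ act w z

/-- Definition of maps out of `X ⊗ star M y z` by recursion on paths. -/
noncomputable def fold (a : X ⟶ Z y) (act : ∀ w z, Z w ⊗ M w z ⟶ Z z) (z : S) :
    X ⊗ star M y z ⟶ Z z :=
  (hA.tensorLeft X (isCoprod_star M y z)).desc fun n => foldPow hA a act n.down z

lemma starι_fold (a : X ⟶ Z y) (act : ∀ w z, Z w ⊗ M w z ⟶ Z z) (n : ℕ) (z : S) :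
    X ◁ starι M n y z ≫ fold hA a act z = foldPow hA a act n z :=
  (hA.tensorLeft X (isCoprod_star M y z)).ι_desc _ ⟨n⟩

lemma starId_fold (a : X ⟶ Z y) (act : ∀ w z, Z w ⊗ M w z ⟶ Z z) :
    X ◁ starId M y ≫ fold hA a act y = (ρ_ X).hom ≫ a := by
  rw [starId, whiskerLeft_comp_assoc, starι_fold]
  refine ((hA.tensorLeft X (isCoprod_pow_zero M y y)).ι_desc _ ⟨⟨rfl⟩⟩).trans ?_
  simp

lemma starStep_fold (a : X ⟶ Z y) (act : ∀ w z, Z w ⊗ M w z ⟶ Z z) (w z : S) :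
    X ◁ starStep hA M y w z ≫ fold hA a act z =
      (α_ _ _ _).inv ≫ fold hA a act w ▷ M w z ≫ act w z := by
  refine (hA.tensorLeft X (hA.tensorRight (M w z) (isCoprod_star M y w))).hom_ext fun n => ?_
  rw [← whiskerLeft_comp_assoc, starι_starStep, whiskerLeft_comp_assoc, starι_fold]
  refine ((hA.tensorLeft X (isCoprod_pow_succ M n.down y z)).ι_desc _ w).trans ?_
  rw [associator_inv_naturality_middle_assoc, ← comp_whiskerRight_assoc, starι_fold]

end Fold

/-- Concatenation of paths. -/
noncomputable def starComp (x y z : S) : star M x y ⊗ star M y z ⟶ star M x z :=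
  fold hA (Z := fun z => star M x z) (𝟙 (star M x y)) (fun w z => starStep hA M x w z) z

@[simp]
lemma starId_starComp (x y : S) :
    star M x y ◁ starId M y ≫ starComp hA M x y y = (ρ_ _).hom :=
  (starId_fold hA _ _).trans (Category.comp_id _)

@[simp]
lemma starStep_starComp (x y w z : S) :
    star M x y ◁ starStep hA M y w z ≫ starComp hA M x y z =
      (α_ _ _ _).inv ≫ starComp hA M x y w ▷ M w z ≫ starStep hA M x w z :=
  starStep_fold hA _ _ w z

/-- Both sides, as functions of the second path, satisfy the same recursion, so they agree by
`hom_ext_tensor_star`. -/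
lemma id_starComp (x y : S) :
    (λ_ (star M x y)).inv ≫ starId M x ▷ _ ≫ starComp hA M x x y = 𝟙 _ := by
  rw [Iso.inv_comp_eq, Category.comp_id]
  refine hom_ext_tensor_star hA (Z := fun z => star M x z) (fun w z => starStep hA M x w z)
    (f := fun z => starId M x ▷ star M x z ≫ starComp hA M x x z) (g := fun z => (λ_ _).hom)
    ?_ ?_ ?_ y
  · rw [whisker_exchange_assoc, starId_starComp]
    simp [unitors_equal]
  · intro w z
    rw [whisker_exchange_assoc, starStep_starComp]
    simp
  · intro w z
    simp

/-- Induction on the third path: the empty path is a right unit, and appending an edge commutes with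
concatenation on the left. -/
lemma starComp_assoc (x y z t : S) :
    (α_ _ _ _).inv ≫ starComp hA M x y z ▷ _ ≫ starComp hA M x z t =
      _ ◁ starComp hA M y z t ≫ starComp hA M x y t := by
  rw [Iso.inv_comp_eq]
  refine hom_ext_tensor_star hA (Z := fun z => star M x z) (fun w z => starStep hA M x w z)
    (f := fun t => starComp hA M x y z ▷ star M z t ≫ starComp hA M x z t)
    (g := fun t => (α_ _ _ _).hom ≫ _ ◁ starComp hA M y z t ≫ starComp hA M x y t) ?_ ?_ ?_ t
  · rw [whisker_exchange_assoc, starId_starComp]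
    have := (α_ (star M x y) (star M y z) (𝟙_ A)).hom ≫= congrArg (star M x y ◁ ·)
      (starId_starComp hA M y z) =≫ starComp hA M x y z
    simp only [whiskerLeft_comp, Category.assoc] at this
    rw [associator_naturality_right_assoc, this]
    simp
  · intro w t
    rw [whisker_exchange_assoc, starStep_starComp]
    simp
  · intro w t
    rw [associator_naturality_right_assoc, ← whiskerLeft_comp_assoc, starStep_starComp]
    simp

/-- The free category on a graph. -/
noncomputable def freeCat (G : VGph.{w} A) : VCat.{w} A where
  ob := G.ob
  str :=
    { Hom := star G.hom
      id := starId G.hom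
      comp := starComp hA G.hom
      id_comp := id_starComp hA G.hom
      comp_id := fun x y => by rw [starId_starComp, Iso.inv_hom_id]
      assoc := starComp_assoc hA G.hom }

/-- The inclusion of edges into paths. -/
noncomputable def starη (x y : S) : M x y ⟶ star M x y :=
  (λ_ _).inv ≫ starId M x ▷ _ ≫ starStep hA M x x y

@[simp]
lemma starη_starComp (x y z : S) :
    star M x y ◁ starη hA M y z ≫ starComp hA M x y z = starStep hA M x y z := by
  simp only [starη, whiskerLeft_comp, Category.assoc, starStep_starComp]
  rw [associator_inv_naturality_middle_assoc, ← comp_whiskerRight_assoc, starId_starComp]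
  simp

/-! ### Extension of a graph map to the free category -/

section Extend

variable {M} {C : VCat.{w} A} {φ : S → C.ob}
  (g : ∀ x y, M x y ⟶ EnrichedCategory.Hom (φ x) (φ y))

/-- The extension of a map of graphs into a category to paths. -/
noncomputable def starExtend (x z : S) : star M x z ⟶ EnrichedCategory.Hom (φ x) (φ z) :=
  (λ_ _).inv ≫ fold hA (Z := fun z => EnrichedCategory.Hom (φ x) (φ z)) (eId A (φ x))
    (fun w z => _ ◁ g w z ≫ eComp A _ _ _) z

@[simp]
lemma starId_starExtend (x : S) : starId M x ≫ starExtend hA g x x = eId A (φ x) := by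
  rw [starExtend, leftUnitor_inv_naturality_assoc, starId_fold, unitors_inv_equal]
  exact Iso.inv_hom_id_assoc _ _

@[simp]
lemma starStep_starExtend (x w z : S) :
    starStep hA M x w z ≫ starExtend hA g x z =
      (starExtend hA g x w ⊗ₘ g w z) ≫ eComp A _ _ _ := by
  rw [starExtend, leftUnitor_inv_naturality_assoc, starStep_fold, starExtend]
  simp [MonoidalCategory.tensorHom_def]

@[simp]
lemma starη_starExtend (x y : S) : starη hA M x y ≫ starExtend hA g x y = g x y := by
  rw [starη, Category.assoc, Category.assoc, starStep_starExtend,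
    whiskerRight_comp_tensorHom_assoc, starId_starExtend]
  simp [tensorHom_def']

/-- Induction on the second path; the inductive step is associativity in `C`. -/
lemma starComp_starExtend (x y z : S) :
    starComp hA M x y z ≫ starExtend hA g x z =
      (starExtend hA g x y ⊗ₘ starExtend hA g y z) ≫ eComp A _ _ _ := by
  refine hom_ext_tensor_star hA (Z := fun z => (EnrichedCategory.Hom (φ x) (φ z) : A))
    (fun w z => _ ◁ g w z ≫ eComp A _ _ _)
    (f := fun z => starComp hA M x y z ≫ starExtend hA g x z)
    (g := fun z => (starExtend hA g x y ⊗ₘ starExtend hA g y z) ≫ eComp A _ _ _) ?_ ?_ ?_ z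
  · rw [reassoc_of% @starId_starComp, whiskerLeft_comp_tensorHom_assoc, starId_starExtend]
    simp [MonoidalCategory.tensorHom_def]
  · intro w z
    rw [reassoc_of% @starStep_starComp, starStep_starExtend]
    simp [MonoidalCategory.tensorHom_def]
  · intro w z
    rw [whiskerLeft_comp_tensorHom_assoc, starStep_starExtend]
    have h₁ : (starExtend hA g x y ⊗ₘ (starExtend hA g y w ⊗ₘ g w z) ≫ eComp A _ _ _) =
        (starExtend hA g x y ⊗ₘ starExtend hA g y w ⊗ₘ g w z) ≫
          (EnrichedCategory.Hom (φ x) (φ y) : A) ◁ eComp A (φ y) (φ w) (φ z) := by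
      rw [tensorHom_comp_whiskerLeft]
    rw [h₁, Category.assoc, ← e_assoc, associator_inv_naturality_assoc,
      tensorHom_comp_whiskerRight_assoc, MonoidalCategory.tensorHom_def (_ ≫ _) (g w z),
      Category.assoc]

end Extend

end VMat

/-! ### Cartesian squares of matrices -/

lemma CategoryTheory.IsPullback.tensor {A : Type u} [Category.{v} A] [CartesianMonoidalCategory A]
    {P X Y Z P' X' Y' Z' : A} {a : P ⟶ X} {b : P ⟶ Y} {f : X ⟶ Z} {g : Y ⟶ Z}
    {a' : P' ⟶ X'} {b' : P' ⟶ Y'} {f' : X' ⟶ Z'} {g' : Y' ⟶ Z'}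
    (h : IsPullback a b f g) (h' : IsPullback a' b' f' g') :
    IsPullback (a ⊗ₘ a') (b ⊗ₘ b') (f ⊗ₘ f') (g ⊗ₘ g') where
  w := by simp [h.w, h'.w]
  isLimit' := ⟨PullbackCone.IsLimit.mk _
    (fun s => CartesianMonoidalCategory.lift
      (h.lift (s.fst ≫ fst _ _) (s.snd ≫ fst _ _) (by simpa using s.condition =≫ fst _ _))
      (h'.lift (s.fst ≫ snd _ _) (s.snd ≫ snd _ _) (by simpa using s.condition =≫ snd _ _)))
    (fun s => by ext <;> simp) (fun s => by ext <;> simp)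
    (fun s m h₁ h₂ => by
      ext
      · exact h.hom_ext (by simp [← h₁]) (by simp [← h₂])
      · exact h'.hom_ext (by simp [← h₁]) (by simp [← h₂]))⟩

namespace VMat

variable {A : Type u} [Category.{v} A] [CartesianMonoidalCategory A] [HasCoproducts.{w} A]
  {S S' S'' : Type w}

/-! ### Functoriality of products, powers and paths -/

section Maps

/-- The map between products of matrices induced by maps of matrices over a map of index sets. -/
noncomputable def mulMap {M N : S → S → A} {M' N' : S' → S' → A} (φ : S → S')
    (α : ∀ x y, M x y ⟶ M' (φ x) (φ y)) (β : ∀ x y, N x y ⟶ N' (φ x) (φ y)) (x z : S) :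
    mul M N x z ⟶ mul M' N' (φ x) (φ z) :=
  (isCoprod_mul M N x z).desc fun y => (α x y ⊗ₘ β y z) ≫ mulι M' N' _ _ _

@[simp]
lemma mulι_mulMap {M N : S → S → A} {M' N' : S' → S' → A} (φ : S → S')
    (α : ∀ x y, M x y ⟶ M' (φ x) (φ y)) (β : ∀ x y, N x y ⟶ N' (φ x) (φ y)) (x y z : S) :
    mulι M N x y z ≫ mulMap φ α β x z = (α x y ⊗ₘ β y z) ≫ mulι M' N' _ _ _ :=
  (isCoprod_mul M N x z).ι_desc _ y

@[simp]
lemma mulι_mulMap_assoc {M N : S → S → A} {M' N' : S' → S' → A} (φ : S → S')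
    (α : ∀ x y, M x y ⟶ M' (φ x) (φ y)) (β : ∀ x y, N x y ⟶ N' (φ x) (φ y)) (x y z : S) {Z : A}
    (k : mul M' N' (φ x) (φ z) ⟶ Z) :
    mulι M N x y z ≫ mulMap φ α β x z ≫ k = (α x y ⊗ₘ β y z) ≫ mulι M' N' _ _ _ ≫ k := by
  rw [← Category.assoc, mulι_mulMap, Category.assoc]

/-- Powers of a map of matrices. -/
noncomputable def powMap {M : S → S → A} {N : S' → S' → A} {φ : S → S'}
    (f : ∀ x y, M x y ⟶ N (φ x) (φ y)) : ∀ (n : ℕ) (x z : S), pow M n x z ⟶ pow N n (φ x) (φ z)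
  | 0, x, z => (isCoprod_pow_zero M x z).desc fun h => powZeroι N (congrArg φ h.down.down)
  | n + 1, x, z => (isCoprod_pow_succ M n x z).desc fun y =>
      (powMap f n x y ⊗ₘ f y z) ≫ powSuccι N n _ _ _

variable {M : S → S → A} {N : S' → S' → A} {φ : S → S'} (f : ∀ x y, M x y ⟶ N (φ x) (φ y))

@[simp]
lemma powZeroι_powMap {x z : S} (h : x = z) :
    powZeroι M h ≫ powMap f 0 x z = powZeroι N (congrArg φ h) :=
  (isCoprod_pow_zero M x z).ι_desc _ ⟨⟨h⟩⟩

@[simp]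
lemma powZeroι_powMap_assoc {x z : S} (h : x = z) {Z : A} (k : pow N 0 (φ x) (φ z) ⟶ Z) :
    powZeroι M h ≫ powMap f 0 x z ≫ k = powZeroι N (congrArg φ h) ≫ k := by
  rw [← Category.assoc, powZeroι_powMap]

@[simp]
lemma powSuccι_powMap (n : ℕ) (x y z : S) :
    powSuccι M n x y z ≫ powMap f (n + 1) x z = (powMap f n x y ⊗ₘ f y z) ≫ powSuccι N n _ _ _ :=
  (isCoprod_pow_succ M n x z).ι_desc _ y

/-- The sum of all powers of a map of matrices. -/
noncomputable def starMap (x z : S) : star M x z ⟶ star N (φ x) (φ z) :=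
  (isCoprod_star M x z).desc fun n => powMap f n.down x z ≫ starι N n.down _ _

@[simp]
lemma starι_starMap (n : ℕ) (x z : S) :
    starι M n x z ≫ starMap f x z = powMap f n x z ≫ starι N n _ _ :=
  (isCoprod_star M x z).ι_desc _ ⟨n⟩

@[simp]
lemma starId_starMap (x : S) : starId M x ≫ starMap f x x = starId N (φ x) := by
  simp [starId]

variable (hA : HasVanKampenCoproducts.{w} A)

@[simp]
lemma starStep_starMap (x y z : S) :
    starStep hA M x y z ≫ starMap f x z =
      (starMap f x y ⊗ₘ f y z) ≫ starStep hA N _ _ _ := by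
  refine (hA.tensorRight (M y z) (isCoprod_star M x y)).hom_ext fun n => ?_
  rw [starι_starStep_assoc, starι_starMap, reassoc_of% @powSuccι_powMap,
    whiskerRight_comp_tensorHom_assoc, starι_starMap, ← tensorHom_comp_whiskerRight,
    Category.assoc, starι_starStep]

@[simp]
lemma starη_starMap (x y : S) :
    starη hA M x y ≫ starMap f x y = f x y ≫ starη hA N _ _ := by
  simp only [starη, Category.assoc, starStep_starMap, whiskerRight_comp_tensorHom_assoc,
    starId_starMap]
  simp [tensorHom_def']

@[simp]
lemma starComp_starMap (x y z : S) :
    starComp hA M x y z ≫ starMap f x z =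
      (starMap f x y ⊗ₘ starMap f y z) ≫ starComp hA N _ _ _ := by
  refine hom_ext_tensor_star hA (Z := fun z => star N (φ x) (φ z))
    (fun w z => _ ◁ f w z ≫ starStep hA N _ _ _)
    (f := fun z => starComp hA M x y z ≫ starMap f x z)
    (g := fun z => (starMap f x y ⊗ₘ starMap f y z) ≫ starComp hA N _ _ _) ?_ ?_ ?_ z
  · rw [reassoc_of% @starId_starComp, whiskerLeft_comp_tensorHom_assoc, starId_starMap,
      MonoidalCategory.tensorHom_def, Category.assoc, starId_starComp, rightUnitor_naturality]
  · intro w z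
    rw [reassoc_of% @starStep_starComp, starStep_starMap]
    simp [MonoidalCategory.tensorHom_def]
  · intro w z
    rw [whiskerLeft_comp_tensorHom_assoc, starStep_starMap]
    have h₁ : (starMap f x y ⊗ₘ (starMap f y w ⊗ₘ f w z) ≫ starStep hA N _ _ _) =
        (starMap f x y ⊗ₘ starMap f y w ⊗ₘ f w z) ≫ _ ◁ starStep hA N _ _ _ := by
      rw [tensorHom_comp_whiskerLeft]
    rw [h₁, Category.assoc, starStep_starComp, associator_inv_naturality_assoc,
      tensorHom_comp_whiskerRight_assoc, MonoidalCategory.tensorHom_def (_ ≫ _) (f w z),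
      Category.assoc]

end Maps

/-! ### Cartesianness of one-edge paths and of concatenation -/

section Cartesian

variable (hA : HasVanKampenCoproducts.{w} A)

-- Each summand is a product of two pullback squares, and the intermediate object is carried along
-- `φ`; hence the reindexed form of the coproduct lemma.
include hA in
lemma isPullback_mulMap [HasPullbacks A] {φ : S → S'} {M N K L : S → S → A}
    {M' N' K' L' : S' → S' → A}
    {α : ∀ x y, M x y ⟶ M' (φ x) (φ y)} {β : ∀ x y, N x y ⟶ N' (φ x) (φ y)}
    {α' : ∀ x y, K x y ⟶ K' (φ x) (φ y)} {β' : ∀ x y, L x y ⟶ L' (φ x) (φ y)}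
    {l : ∀ x y, M x y ⟶ K x y} {r : ∀ x y, M' x y ⟶ K' x y}
    {l' : ∀ x y, N x y ⟶ L x y} {r' : ∀ x y, N' x y ⟶ L' x y}
    (h : ∀ x y, IsPullback (α x y) (l x y) (r _ _) (α' x y))
    (h' : ∀ x y, IsPullback (β x y) (l' x y) (r' _ _) (β' x y)) (x z : S) :
    IsPullback (mulMap φ α β x z) (mulMap (fun x => x) l l' x z)
      (mulMap (fun x => x) r r' (φ x) (φ z)) (mulMap φ α' β' x z) :=
  hA.isPullback_reindex φ (isCoprod_mul M N x z) (isCoprod_mul K L x z)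
    (isCoprod_mul M' N' _ _) (isCoprod_mul K' L' _ _)
    (m := fun y => (r (φ x) y ⊗ₘ r' y (φ z)))
    (fun y => (h x y).tensor (h' y z)) (fun _ => mulι_mulMap _ _ _ _ _ _)
    (fun _ => mulι_mulMap _ _ _ _ _ _) (fun _ => mulι_mulMap _ _ _ _ _ _)
    (fun _ => mulι_mulMap _ _ _ _ _ _)

variable (M : S → S → A)

/-- Appending an edge to a path, summed over the position of the edge. -/
noncomputable def stepSum (x z : S) : mul (star M) M x z ⟶ star M x z :=
  (isCoprod_mul _ _ x z).desc fun y => starStep hA M x y z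

/-- Concatenation with paths of length `n`, summed over the middle object. -/
noncomputable def compPowSum (n : ℕ) (x z : S) : mul (star M) (pow M n) x z ⟶ star M x z :=
  (isCoprod_mul _ _ x z).desc fun y => _ ◁ starι M n y z ≫ starComp hA M x y z

/-- Concatenation of paths, summed over the middle object. -/
noncomputable def compSum (x z : S) : mul (star M) (star M) x z ⟶ star M x z :=
  (isCoprod_mul _ _ x z).desc fun y => starComp hA M x y z

@[simp]
lemma mulι_stepSum (x y z : S) : mulι _ _ x y z ≫ stepSum hA M x z = starStep hA M x y z :=
  (isCoprod_mul _ _ x z).ι_desc _ y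

@[simp]
lemma mulι_compPowSum (n : ℕ) (x y z : S) :
    mulι _ _ x y z ≫ compPowSum hA M n x z = _ ◁ starι M n y z ≫ starComp hA M x y z :=
  (isCoprod_mul _ _ x z).ι_desc _ y

@[simp]
lemma mulι_compSum (x y z : S) : mulι _ _ x y z ≫ compSum hA M x z = starComp hA M x y z :=
  (isCoprod_mul _ _ x z).ι_desc _ y

/-- The inclusion of the paths of length `n + 1` into the paths with a distinguished last edge. -/
noncomputable def succToMul (n : ℕ) (x z : S) : pow M (n + 1) x z ⟶ mul (star M) M x z :=
  (isCoprod_pow_succ M n x z).desc fun y => starι M n x y ▷ _ ≫ mulι _ _ x y z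

@[simp]
lemma powSuccι_succToMul (n : ℕ) (x y z : S) :
    powSuccι M n x y z ≫ succToMul M n x z = starι M n x y ▷ _ ≫ mulι _ _ x y z :=
  (isCoprod_pow_succ M n x z).ι_desc _ y

@[simp]
lemma powSuccι_succToMul_assoc (n : ℕ) (x y z : S) {Z : A} (k : mul (star M) M x z ⟶ Z) :
    powSuccι M n x y z ≫ succToMul M n x z ≫ k = starι M n x y ▷ _ ≫ mulι _ _ x y z ≫ k := by
  rw [← Category.assoc, powSuccι_succToMul, Category.assoc]

-- Distributivity turns (∐_n M^n) M into ∐_n M^(n+1), after exchanging the sums over the length and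
-- over the intermediate object.
include hA in
lemma isCoprod_succToMul (x z : S) :
    IsCoprod (fun n : ULift.{w} ℕ => pow M (n.down + 1) x z) fun n => succToMul M n.down x z := by
  have h := ((isCoprod_mul (star M) M x z).trans fun y =>
    hA.tensorRight (M y z) (isCoprod_star M x y)).reindex
      (⟨fun p => ⟨p.2, p.1⟩, fun p => ⟨p.2, p.1⟩, fun _ => rfl, fun _ => rfl⟩ :
        (Σ _ : ULift.{w} ℕ, S) ≃ (Σ _ : S, ULift.{w} ℕ))
  exact h.of_trans (fun n => isCoprod_pow_succ M n.down x z)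
    fun n y => powSuccι_succToMul M n.down x y z

variable {M} {N : S' → S' → A} {φ : S → S'} (f : ∀ x y, M x y ⟶ N (φ x) (φ y))

/-- Appending an edge identifies its domain with the summands of positive length. On summands the
square has identities as two opposite sides, and the index map is n ↦ n + 1. -/
lemma isPullback_stepSum [HasPullbacks A] (x z : S) :
    IsPullback (mulMap φ (starMap f) f x z) (stepSum hA M x z) (stepSum hA N _ _)
      (starMap f x z) := by
  refine (hA.isPullback_reindex (fun n : ULift.{w} ℕ => ⟨n.down + 1⟩) (isCoprod_succToMul hA M x z)
    (isCoprod_succToMul hA N (φ x) (φ z)) (isCoprod_star M x z) (isCoprod_star N _ _)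
    (t := fun n => 𝟙 _) (b := fun n => 𝟙 _) (l := fun n => powMap f (n.down + 1) x z)
    (m := fun n => powMap f n.down x z)
    (fun n => IsPullback.of_horiz_isIso ⟨by simp⟩) ?_ ?_ ?_ ?_).flip
  · refine fun n => (isCoprod_pow_succ M n.down x z).hom_ext fun y => ?_
    simp
  · refine fun n => (isCoprod_pow_succ M n.down x z).hom_ext fun y => ?_
    simp only [powSuccι_succToMul_assoc, mulι_mulMap, whiskerRight_comp_tensorHom_assoc,
      starι_starMap, reassoc_of% @powSuccι_powMap, powSuccι_succToMul,
      tensorHom_comp_whiskerRight_assoc]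
  · exact fun n => starι_starMap f _ _ _
  · refine fun n => (isCoprod_pow_succ N n.down _ _).hom_ext fun y => ?_
    simp

/-- Concatenation with empty paths is invertible. -/
lemma isIso_compPowSum_zero (x z : S) : IsIso (compPowSum hA M 0 x z) := by
  have h := (isCoprod_mul (star M) (pow M 0) x z).trans fun y =>
    hA.tensorLeft (star M x y) (isCoprod_pow_zero M y z)
  -- Only `y = z` contributes to this sum, so it consists of the single summand `star M x z ⊗ 𝟙_ A`.
  have h' : IsCoprod (fun p : Σ y, ULift.{w} (PLift (y = z)) => star M x p.1 ⊗ 𝟙_ A)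
      fun p => (ρ_ _).hom ≫ eqToHom (by rw [p.2.down.down]) := fun Z k =>
    ⟨(ρ_ _).inv ≫ k ⟨z, ⟨⟨rfl⟩⟩⟩, by rintro ⟨y, ⟨⟨rfl⟩⟩⟩; simp, fun g hg => by
      rw [← hg]; simp⟩
  refine h.isIso_of_comp h' _ ?_
  rintro ⟨y, ⟨⟨rfl⟩⟩⟩
  have := starId_starComp hA M x y
  simp only [starId, whiskerLeft_comp, Category.assoc] at this
  simp [this]

/-- Reassociation of products of matrices. -/
noncomputable def mulAssoc (n : ℕ) (x z : S) :
    mul (star M) (pow M (n + 1)) x z ⟶ mul (mul (star M) (pow M n)) M x z :=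
  (isCoprod_mul _ _ x z).desc fun y =>
    (hA.tensorLeft _ (isCoprod_pow_succ M n y z)).desc fun t =>
      (α_ _ _ _).inv ≫ mulι (star M) (pow M n) x y t ▷ _ ≫ mulι _ _ x t z

@[simp]
lemma mulι_mulAssoc (n : ℕ) (x y t z : S) :
    star M x y ◁ powSuccι M n y t z ≫ mulι _ _ x y z ≫ mulAssoc hA n x z =
      (α_ _ _ _).inv ≫ mulι (star M) (pow M n) x y t ▷ _ ≫ mulι _ _ x t z := by
  rw [mulAssoc, (isCoprod_mul (star M) (pow M (n + 1)) x z).ι_desc,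
    (hA.tensorLeft _ (isCoprod_pow_succ M n y z)).ι_desc _ t]

/-- Both sides are coproducts of the same triple products, indexed by the two intermediate objects
in either order. -/
lemma isIso_mulAssoc (n : ℕ) (x z : S) : IsIso (mulAssoc hA (M := M) n x z) := by
  have h := (isCoprod_mul (star M) (pow M (n + 1)) x z).trans fun y =>
    hA.tensorLeft (star M x y) (isCoprod_pow_succ M n y z)
  have h' := (((isCoprod_mul (mul (star M) (pow M n)) M x z).trans fun t =>
    hA.tensorRight (M t z) (isCoprod_mul (star M) (pow M n) x t)).reindex
      (⟨fun p => ⟨p.2, p.1⟩, fun p => ⟨p.2, p.1⟩, fun _ => rfl, fun _ => rfl⟩ :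
        (Σ _ : S, S) ≃ (Σ _ : S, S))).iso_comp fun p => (α_ _ _ _).symm
  exact h.isIso_of_comp h' _ fun p => by simp

/-- Concatenating with a path of length n + 1 means concatenating with its first n edges and then
appending the last one. This gives an induction using only the cartesian square for appending an
edge. -/
lemma mulAssoc_compPowSum (n : ℕ) (x z : S) :
    mulAssoc hA n x z ≫ mulMap (fun x => x) (compPowSum hA M n) (fun _ _ => 𝟙 _) x z ≫
      stepSum hA M x z = compPowSum hA M (n + 1) x z := by
  refine (isCoprod_mul _ _ x z).hom_ext fun y =>
    (hA.tensorLeft _ (isCoprod_pow_succ M n y z)).hom_ext fun t => ?_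
  rw [reassoc_of% @mulι_mulAssoc, mulι_mulMap_assoc, mulι_stepSum, mulι_compPowSum,
    ← whiskerLeft_comp_assoc, ← starι_starStep hA, whiskerLeft_comp_assoc, starStep_starComp,
    whiskerRight_comp_tensorHom_assoc, mulι_compPowSum, tensorHom_id,
    associator_inv_naturality_middle_assoc, comp_whiskerRight_assoc]

lemma mulAssoc_mulMap (n : ℕ) (x z : S) :
    mulMap φ (starMap f) (powMap f (n + 1)) x z ≫ mulAssoc hA n _ _ =
      mulAssoc hA n x z ≫ mulMap φ (mulMap φ (starMap f) (powMap f n)) f x z := by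
  refine (isCoprod_mul _ _ x z).hom_ext fun y =>
    (hA.tensorLeft _ (isCoprod_pow_succ M n y z)).hom_ext fun t => ?_
  rw [reassoc_of% @mulι_mulAssoc, mulι_mulMap_assoc, whiskerLeft_comp_tensorHom_assoc,
    powSuccι_powMap,
    mulι_mulMap, whiskerRight_comp_tensorHom_assoc, mulι_mulMap]
  have h₁ : (starMap f x y ⊗ₘ (powMap f n y t ⊗ₘ f t z) ≫ powSuccι N n (φ y) (φ t) (φ z)) =
      (starMap f x y ⊗ₘ powMap f n y t ⊗ₘ f t z) ≫ _ ◁ powSuccι N n (φ y) (φ t) (φ z) := by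
    rw [tensorHom_comp_whiskerLeft]
  have h₂ : ((starMap f x y ⊗ₘ powMap f n y t) ≫ mulι (star N) (pow N n) _ (φ y) _ ⊗ₘ f t z) =
      ((starMap f x y ⊗ₘ powMap f n y t) ⊗ₘ f t z) ≫ mulι (star N) (pow N n) _ (φ y) _ ▷ _ := by
    rw [tensorHom_comp_whiskerRight]
  rw [h₁, h₂, Category.assoc, mulι_mulAssoc, Category.assoc, associator_inv_naturality_assoc]

lemma isPullback_compPowSum [HasPullbacks A] (n : ℕ) (x z : S) :
    IsPullback (mulMap φ (starMap f) (powMap f n) x z) (compPowSum hA M n x z)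
      (compPowSum hA N n _ _) (starMap f x z) := by
  induction n generalizing x z with
  | zero =>
    have := isIso_compPowSum_zero hA (M := M) x z
    have := isIso_compPowSum_zero hA (M := N) (φ x) (φ z)
    refine IsPullback.of_vert_isIso ⟨(isCoprod_mul _ _ x z).hom_ext fun y => ?_⟩
    rw [mulι_mulMap_assoc, mulι_compPowSum, reassoc_of% @mulι_compPowSum, starComp_starMap,
      tensorHom_comp_whiskerLeft_assoc, whiskerLeft_comp_tensorHom_assoc, starι_starMap]
  | succ n ih =>
    have := isIso_mulAssoc hA (M := M) n x z
    have := isIso_mulAssoc hA (M := N) n (φ x) (φ z)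
    rw [← mulAssoc_compPowSum, ← mulAssoc_compPowSum]
    exact (IsPullback.of_vert_isIso ⟨mulAssoc_mulMap hA f n x z⟩).paste_vert
      ((isPullback_mulMap hA ih (fun x y => IsPullback.of_vert_isIso ⟨by simp⟩) x z).paste_vert
        (isPullback_stepSum hA f x z))

/-- The domain is split by the length of the second path; `isPullback_desc` then assembles the
squares for the individual lengths over the common base. -/
lemma isPullback_compSum [HasPullbacks A] (x z : S) :
    IsPullback (mulMap φ (starMap f) (starMap f) x z) (compSum hA M x z) (compSum hA N _ _)
      (starMap f x z) := by
  have key : ∀ {S : Type w} (M : S → S → A) (x z : S),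
      IsCoprod (fun n : ULift.{w} ℕ => mul (star M) (pow M n.down) x z)
        fun n => mulMap (fun x => x) (fun _ _ => 𝟙 _) (starι M n.down) x z := by
    intro S M x z
    have h := ((isCoprod_mul (star M) (star M) x z).trans fun y =>
      hA.tensorLeft (star M x y) (isCoprod_star M y z)).reindex
        (⟨fun p => ⟨p.2, p.1⟩, fun p => ⟨p.2, p.1⟩, fun _ => rfl, fun _ => rfl⟩ :
          (Σ _ : ULift.{w} ℕ, S) ≃ (Σ _ : S, ULift.{w} ℕ))
    exact h.of_trans (fun n => isCoprod_mul (star M) (pow M n.down) x z) fun n y => by simp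
  refine hA.isPullback_desc (key M x z) (key N (φ x) (φ z))
    (fun n => isPullback_compPowSum hA f n.down x z) ?_ ?_ ?_
  · refine fun n => (isCoprod_mul _ _ x z).hom_ext fun y => ?_
    rw [mulι_mulMap_assoc, mulι_mulMap, mulι_mulMap_assoc, mulι_mulMap, id_tensorHom,
      whiskerLeft_comp_tensorHom_assoc, starι_starMap, id_tensorHom,
      tensorHom_comp_whiskerLeft_assoc]
  · refine fun n => (isCoprod_mul _ _ x z).hom_ext fun y => ?_
    simp
  · refine fun n => (isCoprod_mul _ _ _ _).hom_ext fun y => ?_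
    simp

-- Disjointness: a path has length n exactly when its image does.
include hA in
lemma isPullback_starι (n : ℕ) (x z : S) :
    IsPullback (powMap f n x z) (starι M n x z) (starι N n _ _) (starMap f x z) :=
  (hA.disj (isCoprod_star N (φ x) (φ z)) (isCoprod_star M x z)
    (fun n => starι_starMap f n.down x z) ⟨n⟩).flip

variable (M) in
/-- The identification of edges with paths of length one. -/
noncomputable def toPowOne (x z : S) : M x z ⟶ pow M 1 x z :=
  (λ_ _).inv ≫ powZeroι M rfl ▷ _ ≫ powSuccι M 0 x x z

lemma toPowOne_starι (x z : S) : toPowOne M x z ≫ starι M 1 x z = starη hA M x z := by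
  simp [toPowOne, starη, starId]

lemma toPowOne_powMap (x z : S) :
    toPowOne M x z ≫ powMap f 1 x z = f x z ≫ toPowOne N _ _ := by
  simp only [toPowOne, Category.assoc, powSuccι_powMap, whiskerRight_comp_tensorHom_assoc,
    powZeroι_powMap]
  simp [tensorHom_def']

include hA in
lemma isIso_toPowOne (x z : S) : IsIso (toPowOne M x z) := by
  have h := (isCoprod_pow_succ M 0 x z).trans fun y =>
    hA.tensorRight (M y z) (isCoprod_pow_zero M x y)
  have h' : IsCoprod (fun p : Σ y, ULift.{w} (PLift (x = y)) => 𝟙_ A ⊗ M p.1 z)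
      fun p => (λ_ _).hom ≫ eqToHom (congrArg (M · z) p.2.down.down.symm) := fun Z k =>
    ⟨(λ_ _).inv ≫ k ⟨x, ⟨⟨rfl⟩⟩⟩, by rintro ⟨y, ⟨⟨rfl⟩⟩⟩; simp, fun g hg => by
      rw [← hg]; simp⟩
  refine h'.isIso_of_comp h _ ?_
  rintro ⟨y, ⟨⟨rfl⟩⟩⟩
  simp [toPowOne]

/-- Edges are the summand of length one, up to the invertible map `toPowOne`. -/
lemma isPullback_starη (x z : S) :
    IsPullback (f x z) (starη hA M x z) (starη hA N _ _) (starMap f x z) := by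
  have := isIso_toPowOne hA (M := M) x z
  have := isIso_toPowOne hA (M := N) (φ x) (φ z)
  rw [← toPowOne_starι, ← toPowOne_starι]
  exact IsPullback.paste_vert (IsPullback.of_vert_isIso ⟨(toPowOne_powMap f x z).symm⟩)
    (isPullback_starι hA f 1 x z)

variable (M) in
/-- Concatenation of a path of paths. -/
noncomputable def starμ (x z : S) : star (star M) x z ⟶ star M x z :=
  starExtend hA (C := freeCat hA ⟨S, M⟩) (φ := fun x => x) (fun x y => 𝟙 (star M x y)) x z

lemma starId_starμ (x : S) : starId (star M) x ≫ starμ hA M x x = starId M x :=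
  starId_starExtend hA (C := freeCat hA ⟨S, M⟩) (φ := fun x => x) (fun x y => 𝟙 (star M x y)) x

lemma starStep_starμ (x y z : S) : starStep hA (star M) x y z ≫ starμ hA M x z =
    (starμ hA M x y ⊗ₘ 𝟙 (star M y z)) ≫ starComp hA M x y z :=
  starStep_starExtend hA (C := freeCat hA ⟨S, M⟩) (φ := fun x => x)
    (fun x y => 𝟙 (star M x y)) x y z

lemma starι_zero_starμ (x z : S) :
    starι (star M) 0 x z ≫ starμ hA M x z = starι M 0 x z := by
  refine (isCoprod_pow_zero (star M) x z).hom_ext ?_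
  rintro ⟨⟨rfl⟩⟩
  have := starId_starμ hA (M := M) x
  rw [starId, Category.assoc] at this
  exact this

/-- The recursion that drives `isPullback_starμ`: flatten the first n paths, then concatenate with
the last one. -/
lemma starι_succ_starμ (n : ℕ) (x z : S) :
    starι (star M) (n + 1) x z ≫ starμ hA M x z =
      mulMap (fun x => x) (fun x z => starι (star M) n x z ≫ starμ hA M x z) (fun _ _ => 𝟙 _) x z ≫
        compSum hA M x z := by
  refine (isCoprod_pow_succ (star M) n x z).hom_ext fun y => ?_
  rw [← starι_starStep_assoc hA, starStep_starμ, whiskerRight_comp_tensorHom_assoc]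
  exact ((mulι_mulMap_assoc (fun x => x) (fun x z => starι (star M) n x z ≫ starμ hA M x z)
    (fun _ _ => 𝟙 _) x y z _).trans (congrArg (_ ≫ ·) (mulι_compSum hA M x y z))).symm

/-- Split by the length of the outer path and induct. The inductive step pastes a product of squares
with the square for concatenation; only the inner paths vary in length within each outer summand. -/
lemma isPullback_starμ [HasPullbacks A] (x z : S) :
    IsPullback (starMap (starMap f) x z) (starμ hA M x z) (starμ hA N _ _) (starMap f x z) := by
  refine hA.isPullback_desc (isCoprod_star (star M) x z) (isCoprod_star (star N) _ _)
    (l := fun n => starι (star M) n.down x z ≫ starμ hA M x z)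
    (m := fun n => starι (star N) n.down _ _ ≫ starμ hA N _ _)
    (fun n => ?_) (fun n => starι_starMap _ n.down x z) (fun n => rfl) (fun n => rfl)
  obtain ⟨n⟩ := n
  dsimp only
  induction n generalizing x z with
  | zero =>
    rw [starι_zero_starμ, starι_zero_starμ]
    exact isPullback_starι hA f 0 x z
  | succ n ih =>
    rw [starι_succ_starμ, starι_succ_starμ]
    exact (isPullback_mulMap hA ih (fun x y => IsPullback.of_vert_isIso ⟨by simp⟩) x z).paste_vert
      (isPullback_compSum hA f x z)

end Cartesian

end VMat

/-! ### Preservation of pullbacks -/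

/-- Any competing cone maps to the initial object `X`, so its vertex is initial by strictness. -/
lemma HasVanKampenCoproducts.isPullback_of_isInitial {A : Type u} [Category.{v} A]
    (hA : HasVanKampenCoproducts.{w} A) {P X Y Z : A}
    (hP : Nonempty (IsInitial P)) (hX : Nonempty (IsInitial X)) (a : P ⟶ X) (b : P ⟶ Y)
    (f : X ⟶ Z) (g : Y ⟶ Z) : IsPullback a b f g := by
  refine .of_existsUnique (hP.some.hom_ext _ _) fun W s t _ => ?_
  obtain ⟨hW⟩ := hA.isInitial_of_hom hX.some s
  exact ⟨hW.to P, ⟨hW.hom_ext _ _, hW.hom_ext _ _⟩, fun _ _ => hW.hom_ext _ _⟩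

namespace VMat

variable {A : Type u} [Category.{v} A] [CartesianMonoidalCategory A] [HasCoproducts.{w} A]
  (hA : HasVanKampenCoproducts.{w} A)

lemma isIso_powZeroι {S : Type w} (M : S → S → A) {x z : S} (h : x = z) :
    IsIso (powZeroι M h) := by
  have h' : IsCoprod (fun _ : ULift.{w} (PLift (x = z)) => 𝟙_ A) fun _ => 𝟙 (𝟙_ A) := fun Z k =>
    ⟨k ⟨⟨h⟩⟩, by rintro ⟨⟨h⟩⟩; simp, fun g hg => by rw [← hg]; simp⟩
  exact h'.isIso_of_comp (isCoprod_pow_zero M x z) _ fun _ => by simp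

lemma isInitial_pow_zero {S : Type w} (M : S → S → A) {x z : S} (h : x ≠ z) :
    Nonempty (IsInitial (pow M 0 x z)) :=
  have : IsEmpty (ULift.{w} (PLift (x = z))) := ⟨fun h' => h h'.down.down⟩
  (isCoprod_pow_zero M x z).isInitial

lemma isIso_powMap_zero {S S' : Type w} {M : S → S → A} {N : S' → S' → A} {φ : S → S'}
    (f : ∀ x y, M x y ⟶ N (φ x) (φ y)) {x z : S} (h : x = z) : IsIso (powMap f 0 x z) := by
  have := isIso_powZeroι M h
  have := isIso_powZeroι N (congrArg φ h)
  have h' := powZeroι_powMap f h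
  have : IsIso (powZeroι M h ≫ powMap f 0 x z) := by rw [h']; infer_instance
  exact IsIso.of_isIso_comp_left (powZeroι M h) _

variable {K : Type w} {F E : K → Type w} {X : (Σ k, F k) → (Σ k, F k) → A}
  {Y : (Σ k, E k) → (Σ k, E k) → A} {Z : K → K → A}
  {P : (Σ k, F k × E k) → (Σ k, F k × E k) → A}
  {a : ∀ p q, P p q ⟶ X ⟨p.1, p.2.1⟩ ⟨q.1, q.2.1⟩}
  {b : ∀ p q, P p q ⟶ Y ⟨p.1, p.2.2⟩ ⟨q.1, q.2.2⟩}
  {f : ∀ p q, X p q ⟶ Z p.1 q.1} {g : ∀ p q, Y p q ⟶ Z p.1 q.1}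

-- In the inductive step, the intermediate objects of the pullback graph are exactly the pairs with
-- the same image in `K`, as `isPullback_sigma` requires.
include hA in
lemma isPullback_powMap [HasPullbacks A]
    (H : ∀ p q, IsPullback (a p q) (b p q) (f _ _) (g _ _)) (n : ℕ)
    (p q : Σ k, F k × E k) :
    IsPullback (powMap (φ := fun p : Σ k, F k × E k => (⟨p.1, p.2.1⟩ : Σ k, F k)) a n p q)
      (powMap (φ := fun p : Σ k, F k × E k => (⟨p.1, p.2.2⟩ : Σ k, E k)) b n p q)
      (powMap (φ := Sigma.fst) f n _ _) (powMap (φ := Sigma.fst) g n _ _) := by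
  induction n generalizing p q with
  | zero =>
    -- An entry of the zeroth power is terminal on the diagonal and initial off it, and two objects
    -- of the pullback are equal exactly when both projections agree.
    by_cases hX : (⟨p.1, p.2.1⟩ : Σ k, F k) = ⟨q.1, q.2.1⟩
    · by_cases hY : (⟨p.1, p.2.2⟩ : Σ k, E k) = ⟨q.1, q.2.2⟩
      · have hpq : p = q := by
          obtain ⟨k, i, j⟩ := p
          obtain ⟨k', i', j'⟩ := q
          obtain rfl : k = k' := congrArg Sigma.fst hX
          obtain rfl : i = i' := eq_of_heq (Sigma.mk.inj hX).2
          obtain rfl : j = j' := eq_of_heq (Sigma.mk.inj hY).2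
          rfl
        have := isIso_powMap_zero (φ := fun p : Σ k, F k × E k => (⟨p.1, p.2.1⟩ : Σ k, F k)) a hpq
        have := isIso_powMap_zero (φ := Sigma.fst) g hY
        refine IsPullback.of_horiz_isIso ⟨(isCoprod_pow_zero P p q).hom_ext fun h => ?_⟩
        rw [powZeroι_powMap_assoc, powZeroι_powMap_assoc, powZeroι_powMap, powZeroι_powMap]
      · refine (hA.isPullback_of_isInitial (isInitial_pow_zero _ fun h => hY ?_)
          (isInitial_pow_zero _ hY) _ _ _ _).flip
        rw [h]
    · refine hA.isPullback_of_isInitial (isInitial_pow_zero _ fun h => hX ?_)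
        (isInitial_pow_zero _ hX) _ _ _ _
      rw [h]
  | succ n ih =>
    exact hA.isPullback_sigma (isCoprod_pow_succ X n _ _) (isCoprod_pow_succ Y n _ _)
      (isCoprod_pow_succ Z n _ _) (isCoprod_pow_succ P n p q)
      (a := fun r => powMap (φ := fun p : Σ k, F k × E k => (⟨p.1, p.2.1⟩ : Σ k, F k)) a n p r ⊗ₘ
        a r q)
      (b := fun r => powMap (φ := fun p : Σ k, F k × E k => (⟨p.1, p.2.2⟩ : Σ k, E k)) b n p r ⊗ₘ
        b r q)
      (f := fun r => powMap (φ := Sigma.fst) f n ⟨p.1, p.2.1⟩ r ⊗ₘ f r ⟨q.1, q.2.1⟩)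
      (g := fun r => powMap (φ := Sigma.fst) g n ⟨p.1, p.2.2⟩ r ⊗ₘ g r ⟨q.1, q.2.2⟩)
      (fun r => (ih p r).tensor (H r q)) (fun r => powSuccι_powMap _ _ _ _ _)
      (fun r => powSuccι_powMap _ _ _ _ _) (fun r => powSuccι_powMap _ _ _ _ _)
      (fun r => powSuccι_powMap _ _ _ _ _)

include hA in
lemma isPullback_starMap [HasPullbacks A]
    (H : ∀ p q, IsPullback (a p q) (b p q) (f _ _) (g _ _)) (p q : Σ k, F k × E k) :
    IsPullback (starMap (φ := fun p : Σ k, F k × E k => (⟨p.1, p.2.1⟩ : Σ k, F k)) a p q)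
      (starMap (φ := fun p : Σ k, F k × E k => (⟨p.1, p.2.2⟩ : Σ k, E k)) b p q)
      (starMap (φ := Sigma.fst) f _ _) (starMap (φ := Sigma.fst) g _ _) :=
  hA.isPullback_reindex id (isCoprod_star P p q) (isCoprod_star Y _ _) (isCoprod_star X _ _)
    (isCoprod_star Z _ _) (m := fun n => powMap (φ := Sigma.fst) f n.down _ _)
    (fun n => isPullback_powMap hA H n.down p q) (fun n => starι_starMap _ n.down _ _)
    (fun n => starι_starMap _ n.down _ _) (fun n => starι_starMap _ n.down _ _)
    (fun n => starι_starMap _ n.down _ _)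

/-! ### Uniqueness of the extension to paths -/

section Extend

variable {S S' : Type w} {M : S → S → A}

/-- Appending an edge is concatenation with a one-edge path, so any functor satisfies the recursion
defining the extension of its restriction to edges. -/
lemma starExtend_unique {C : VCat.{w} A} {φ : S → C.ob}
    (m : ∀ x y, star M x y ⟶ EnrichedCategory.Hom (φ x) (φ y))
    (h₁ : ∀ x, starId M x ≫ m x x = eId A (φ x))
    (h₂ : ∀ x y z, starComp hA M x y z ≫ m x z = (m x y ⊗ₘ m y z) ≫ eComp A _ _ _) (x z : S) :
    starExtend hA (fun x y => starη hA M x y ≫ m x y) x z = m x z := by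
  refine hom_ext_star hA (Z := fun z => (EnrichedCategory.Hom (φ x) (φ z) : A))
    (fun t z => _ ◁ (starη hA M t z ≫ m t z) ≫ eComp A _ _ _)
    (f := fun z => starExtend hA (fun x y => starη hA M x y ≫ m x y) x z)
    (g := fun z => m x z) ?_ ?_ ?_ z
  · rw [starId_starExtend, h₁]
  · intro t z
    rw [starStep_starExtend, MonoidalCategory.tensorHom_def, Category.assoc]
  · intro t z
    rw [← reassoc_of% @starη_starComp, h₂, whiskerLeft_comp_tensorHom_assoc,
      MonoidalCategory.tensorHom_def, Category.assoc]

lemma starExtend_eq_starMap {N : S' → S' → A} {φ : S → S'} (f : ∀ x y, M x y ⟶ N (φ x) (φ y))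
    (x z : S) :
    starExtend hA (C := freeCat hA ⟨S', N⟩) (φ := φ) (fun x y => f x y ≫ starη hA N _ _) x z =
      starMap f x z := by
  have := starExtend_unique hA (C := freeCat hA ⟨S', N⟩) (φ := φ) (starMap f)
    (starId_starMap f) (starComp_starMap f hA) x z
  refine Eq.trans ?_ this
  congr 1
  funext x y
  exact (starη_starMap f hA x y).symm

end Extend

end VMat

/-! ### The free category adjunction -/

namespace VCat

variable {A : Type u} [Category.{v} A] [CartesianMonoidalCategory A]

lemma hasPullbacks [HasPullbacks A] : HasPullbacks (VCat.{w} A) :=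
  have : HasEqualizers A := hasEqualizers_of_hasPullbacks_and_binary_products
  hasPullbacks_of_hasBinaryProducts_of_hasEqualizers _

section

open VMat

variable [HasCoproducts.{w} A] (hA : HasVanKampenCoproducts.{w} A)

/-- The universal property of the free category. -/
noncomputable def freeEquiv (G : VGph.{w} A) (C : VCat.{w} A) :
    (freeCat hA G ⟶ C) ≃ (G ⟶ (forget A).obj C) where
  toFun h := VGph.homMk (H := (forget A).obj C) (fobj h)
    fun x y => starη hA G.hom x y ≫ fmap h x y
  invFun f := homMk (C := freeCat hA G) (VGph.Hom.obj f)
    (fun x y => starExtend hA (C := C) (VGph.Hom.map f) x y)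
    (fun x => starId_starExtend hA (C := C) (VGph.Hom.map f) x)
    (fun x y z => starComp_starExtend hA (C := C) (VGph.Hom.map f) x y z)
  left_inv h := by
    obtain ⟨o, m, h₁, h₂, rfl⟩ := exists_eq_homMk h
    exact homMk_eq_iff.2 fun x y => starExtend_unique hA (M := G.hom) (C := C) m h₁ h₂ x y
  right_inv f := VGph.homMk_eq_iff.2 fun x y =>
    starη_starExtend hA (C := C) (VGph.Hom.map f) x y

lemma freeEquiv_naturality (G : VGph.{w} A) (C D : VCat.{w} A) (g : C ⟶ D)
    (h : freeCat hA G ⟶ C) :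
    freeEquiv hA G D (h ≫ g) = freeEquiv hA G C h ≫ (forget A).map g :=
  VGph.homMk_eq_iff.2 fun _ _ => (Category.assoc _ _ _).symm

/-- The free category functor. -/
noncomputable def free : VGph.{w} A ⥤ VCat.{w} A :=
  Adjunction.leftAdjointOfEquiv (freeEquiv hA) fun G _ _ g h => freeEquiv_naturality hA G _ _ g h

/-- The free category functor is left adjoint to the forgetful functor. -/
noncomputable def freeAdj : free hA ⊣ forget.{w} A :=
  Adjunction.adjunctionOfEquivLeft (freeEquiv hA) fun G _ _ g h => freeEquiv_naturality hA G _ _ g h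

/-- On morphisms, `free` is defined by the universal property; this identifies the result with the
map computed summand by summand, to which the coproduct lemmas apply. -/
lemma forget_map_free_map {G H : VGph.{w} A} (f : G ⟶ H) :
    (forget A).map ((free hA).map f) =
      VGph.homMk (G := ⟨G.ob, star G.hom⟩) (H := ⟨H.ob, star H.hom⟩)
        (VGph.Hom.obj (G := G) (H := H) f) (starMap (VGph.Hom.map (G := G) (H := H) f)) := by
  obtain ⟨o, m, rfl⟩ := VGph.exists_eq_homMk f
  refine VGph.homMk_eq_iff.2 fun x y => Eq.trans ?_ (starExtend_eq_starMap hA m x y)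
  refine congrArg (fun k => starExtend hA (M := G.hom) (C := freeCat hA H) (φ := o) k x y) ?_
  funext x y
  exact congrArg (m x y ≫ ·) (Category.comp_id (starη hA H.hom (o x) (o y)))

lemma freeAdj_unit_app (G : VGph.{w} A) :
    (freeAdj hA).unit.app G =
      VGph.homMk (G := G) (H := ⟨G.ob, star G.hom⟩) (fun x => x) (starη hA G.hom) :=
  VGph.homMk_eq_iff.2 fun _ _ => Category.comp_id _

lemma forget_map_freeAdj_counit_app (G : VGph.{w} A) :
    (forget A).map ((freeAdj hA).counit.app ((free hA).obj G)) =
      VGph.homMk (G := ⟨G.ob, star (star G.hom)⟩) (H := ⟨G.ob, star G.hom⟩) (fun x => x)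
        (starμ hA G.hom) :=
  rfl

lemma equifibered_unit : NatTrans.Equifibered (freeAdj hA).unit := fun G H f => by
  obtain ⟨o, m, rfl⟩ := VGph.exists_eq_homMk f
  rw [freeAdj_unit_app, freeAdj_unit_app]
  change IsPullback _ _ _ ((forget A).map ((free hA).map _))
  rw [forget_map_free_map]
  exact VGph.isPullback_of_id fun x y => isPullback_starη hA m x y

variable [HasPullbacks A]

-- The forgetful functor is a conservative right adjoint between categories with the relevant
-- limits. Squares of enriched categories can therefore be tested on underlying graphs.
include hA in
lemma reflectsPullbacks_forget : ReflectsLimitsOfShape WalkingCospan (forget.{w} A) := by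
  have := hasPullbacks.{w} (A := A)
  have := (freeAdj hA).rightAdjoint_preservesLimits
  exact reflectsLimitsOfShape_of_reflectsIsomorphisms

lemma preservesPullbacks_free : PreservesLimitsOfShape WalkingCospan (free hA) := by
  have := reflectsPullbacks_forget hA
  refine VGph.preservesPullbacks_of_sigma _ fun H => ?_
  have w := (VGph.isPullback_of_sigma H).w
  refine IsPullback.of_map (forget A) (by rw [← Functor.map_comp, w, Functor.map_comp]) ?_
  simp only [forget_map_free_map]
  exact VGph.isPullback_of_sigma fun p q => isPullback_starMap hA H p q

/-- The naturality squares of the counit at free functors are pullbacks. -/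
lemma isPullback_counit {G H : VGph.{w} A} (f : G ⟶ H) :
    IsPullback ((free hA).map ((forget A).map ((free hA).map f)))
      ((freeAdj hA).counit.app ((free hA).obj G)) ((freeAdj hA).counit.app ((free hA).obj H))
      ((free hA).map f) := by
  have := reflectsPullbacks_forget hA
  obtain ⟨o, m, rfl⟩ := VGph.exists_eq_homMk f
  refine IsPullback.of_map (forget A) ((freeAdj hA).counit.naturality _) ?_
  rw [forget_map_freeAdj_counit_app, forget_map_freeAdj_counit_app]
  have e : (forget A).map ((free hA).map ((forget A).map ((free hA).map
      (VGph.homMk (G := G) (H := H) o m)))) =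
      VGph.homMk (G := ⟨G.ob, star (star G.hom)⟩) (H := ⟨H.ob, star (star H.hom)⟩) o
        (starMap (starMap m)) :=
    (congrArg (fun k => (forget A).map ((free hA).map k)) (forget_map_free_map hA _)).trans
      (forget_map_free_map hA (G := ⟨G.ob, star G.hom⟩) (H := ⟨H.ob, star H.hom⟩)
        (VGph.homMk o (starMap m)))
  rw [e, forget_map_free_map]
  exact VGph.isPullback_of_id fun x y => isPullback_starμ hA m x y

end

end VCat

/-! ### Morphisms at which the counit is cartesian -/

section CounitCartesian

variable {A : Type u} [Category.{v} A] {B : Type u₁} [Category.{v₁} B] {F : B ⥤ A} {U : A ⥤ B}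

/-- The naturality square of the counit of `F ⊣ U` at `f` is a pullback. -/
def CounitCartesian (adj : F ⊣ U) {X Y : A} (f : X ⟶ Y) : Prop :=
  IsPullback (F.map (U.map f)) (adj.counit.app X) (adj.counit.app Y) f

namespace CounitCartesian

variable {adj : F ⊣ U}

lemma of_isIso {X Y : A} (f : X ⟶ Y) [IsIso f] : CounitCartesian adj f :=
  IsPullback.of_horiz_isIso ⟨adj.counit.naturality f⟩

lemma comp {X Y Z : A} {f : X ⟶ Y} {g : Y ⟶ Z} (hf : CounitCartesian adj f)
    (hg : CounitCartesian adj g) : CounitCartesian adj (f ≫ g) := by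
  have := IsPullback.paste_horiz hf hg
  rwa [← F.map_comp, ← U.map_comp] at this

/-- The composite of `U` and `F` preserves the given square. Pasting with the counit square at `f`,
rewriting by naturality and cancelling the given square leaves the counit square at `b`. -/
lemma of_isPullback [PreservesLimitsOfShape WalkingCospan F] {P X Y Z : A} {a : P ⟶ X}
    {b : P ⟶ Y} {f : X ⟶ Z} {g : Y ⟶ Z} (h : IsPullback a b f g) (hf : CounitCartesian adj f) :
    CounitCartesian adj b := by
  have : PreservesLimitsOfSize.{0, 0} U := adj.rightAdjoint_preservesLimits
  have h₁ := ((h.map U).map F).paste_horiz (IsPullback.flip hf)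
  have e : ∀ {X Y : A} (k : X ⟶ Y),
      F.map (U.map k) ≫ adj.counit.app Y = adj.counit.app X ≫ k :=
    fun k => adj.counit.naturality k
  rw [e, e] at h₁
  exact (IsPullback.of_right h₁ (e b).symm h).flip

/-- The property does not depend on the choice of the left adjoint. -/
lemma of_adjunction {F' : B ⥤ A} {adj' : F' ⊣ U} {X Y : A} {f : X ⟶ Y}
    (hf : CounitCartesian adj f) : CounitCartesian adj' f := by
  let e : F' ≅ F := adj'.leftAdjointUniq adj
  have h : IsPullback (F'.map (U.map f)) (e.hom.app (U.obj X)) (e.hom.app (U.obj Y))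
      (F.map (U.map f)) := IsPullback.of_vert_isIso ⟨e.hom.naturality _⟩
  have := h.paste_vert hf
  simp only [e, Adjunction.leftAdjointUniq_hom_app_counit] at this
  exact this

/-- The composite of `U` and `F` preserves coproducts, `F` being a left adjoint, so the counit
square at `g` is a coproduct of counit squares. -/
lemma coprod [HasPullbacks A] (hA : HasVanKampenCoproducts.{w} A)
    [∀ I : Type w, PreservesColimitsOfShape (Discrete I) U] {I J : Type w} (r : I → J)
    {X : I → A} {Y : J → A} {S T : A} {x : ∀ i, X i ⟶ S} {y : ∀ j, Y j ⟶ T}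
    (hx : IsCoprod X x) (hy : IsCoprod Y y) {f : ∀ i, X i ⟶ Y (r i)}
    (hf : ∀ i, CounitCartesian adj (f i)) {g : S ⟶ T} (hg : ∀ i, x i ≫ g = f i ≫ y (r i)) :
    CounitCartesian adj g := by
  have := adj.leftAdjoint_preservesColimits
  refine hA.isPullback_reindex r ((hx.map U).map F) hx ((hy.map U).map F) hy
    (m := fun j => adj.counit.app (Y j)) hf (fun i => ?_)
    (fun i => adj.counit.naturality _) (fun i => adj.counit.naturality _) hg
  rw [← F.map_comp, ← U.map_comp, hg, U.map_comp, F.map_comp]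

variable [CartesianMonoidalCategory A]

/-- `f ⊗ₘ g` factors as `f ▷ X'` followed by `Y ◁ g`, which are pullbacks of `f` and of `g` along
projections. -/
lemma tensor [PreservesLimitsOfShape WalkingCospan F] {X Y X' Y' : A} {f : X ⟶ Y} {g : X' ⟶ Y'}
    (hf : CounitCartesian adj f) (hg : CounitCartesian adj g) : CounitCartesian adj (f ⊗ₘ g) := by
  have h₁ : IsPullback (fst X X') (f ▷ X') f (fst Y X') := by
    refine .of_existsUnique (by simp) fun W s t h => ⟨lift s (t ≫ snd _ _), ⟨by simp, ?_⟩, ?_⟩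
    · ext <;> simp [h]
    · rintro m ⟨rfl, rfl⟩
      ext <;> simp
  have h₂ : IsPullback (snd Y X') (Y ◁ g) g (snd Y Y') := by
    refine .of_existsUnique (by simp) fun W s t h => ⟨lift (t ≫ fst _ _) s, ⟨by simp, ?_⟩, ?_⟩
    · ext <;> simp [h]
    · rintro m ⟨rfl, rfl⟩
      ext <;> simp
  rw [MonoidalCategory.tensorHom_def]
  exact (of_isPullback h₁ hf).comp (of_isPullback h₂ hg)

open VMat

variable [HasCoproducts.{w} A] [HasPullbacks A] (hA : HasVanKampenCoproducts.{w} A)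
  [∀ I : Type w, PreservesColimitsOfShape (Discrete I) U] [PreservesLimitsOfShape WalkingCospan F]
  {S S' : Type w} {M : S → S → A} {N : S' → S' → A} {φ : S → S'}
  {f : ∀ x y, M x y ⟶ N (φ x) (φ y)}

include hA in
lemma powMap (hf : ∀ x y, CounitCartesian adj (f x y)) (n : ℕ) (x z : S) :
    CounitCartesian adj (VMat.powMap f n x z) := by
  induction n generalizing z with
  | zero =>
    exact coprod hA (fun h => ⟨⟨congrArg φ h.down.down⟩⟩) (isCoprod_pow_zero M x z)
      (isCoprod_pow_zero N (φ x) (φ z)) (f := fun _ => 𝟙 _) (fun _ => of_isIso _)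
      fun h => by rw [powZeroι_powMap, Category.id_comp]
  | succ n ih =>
    exact coprod hA φ (isCoprod_pow_succ M n x z) (isCoprod_pow_succ N n (φ x) (φ z))
      (fun y => (ih y).tensor (hf y z)) fun y => powSuccι_powMap f n x y z

include hA in
lemma starMap (hf : ∀ x y, CounitCartesian adj (f x y)) (x z : S) :
    CounitCartesian adj (VMat.starMap f x z) :=
  coprod hA id (isCoprod_star M x z) (isCoprod_star N (φ x) (φ z))
    (fun n => powMap hA hf n.down x z) fun n => starι_starMap f n.down x z

end CounitCartesian

end CounitCartesian

/-! ### Iterating the free category construction -/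

/-- The properties of the forgetful functor `U : A ⥤ B` which are inherited by the forgetful functor
from categories enriched in `A` to graphs enriched in `B`. -/
structure IsCartesianForgetful {A : Type u} [Category.{v} A] {B : Type u₁} [Category.{v₁} B]
    (U : A ⥤ B) : Prop where
  hasPullbacks_source : HasPullbacks A
  hasPullbacks_target : HasPullbacks B
  hasVanKampenCoproducts : HasVanKampenCoproducts.{w} A
  preservesCoproducts : ∀ I : Type w, PreservesColimitsOfShape (Discrete I) U
  exists_adjunction : ∃ (F : B ⥤ A) (adj : F ⊣ U), PreservesLimitsOfShape WalkingCospan F ∧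
    NatTrans.Equifibered adj.unit ∧ ∀ {X Y : B} (f : X ⟶ Y), CounitCartesian adj (F.map f)

namespace IsCartesianForgetful

open VMat

variable {A : Type u} [Category.{v} A] {B : Type u₁} [Category.{v₁} B] {U : A ⥤ B}

lemma id (hp : HasPullbacks A) (hA : HasVanKampenCoproducts.{w} A) :
    IsCartesianForgetful.{w} (𝟭 A) where
  hasPullbacks_source := hp
  hasPullbacks_target := hp
  hasVanKampenCoproducts := hA
  preservesCoproducts _ := inferInstance
  exists_adjunction := ⟨𝟭 A, Adjunction.id, inferInstance,
    fun _ _ _ => IsPullback.of_vert_isIso ⟨by simp⟩,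
    fun f => by
      have : ∀ X, IsIso ((Adjunction.id (C := A)).counit.app X) := fun X =>
        inferInstanceAs (IsIso (𝟙 X))
      exact IsPullback.of_vert_isIso ⟨Adjunction.id.counit.naturality _⟩⟩

/-- The crux of the iteration: the map on hom-objects is `starMap` of the maps `F.map (m x y)`,
which is built from them by products and coproducts and so stays in the class where the counit is
cartesian. -/
lemma isPullback_counit_mapAdjunction [CartesianMonoidalCategory A] [HasCoproducts.{w} A]
    [HasPullbacks A] (hA : HasVanKampenCoproducts.{w} A)
    [∀ I : Type w, PreservesColimitsOfShape (Discrete I) U] {F : B ⥤ A}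
    [PreservesLimitsOfShape WalkingCospan F] {adj : F ⊣ U}
    (h : ∀ {X Y : B} (f : X ⟶ Y), CounitCartesian adj (F.map f)) {G H : VGph.{w} B} (f : G ⟶ H) :
    CounitCartesian (VGph.mapAdjunction.{w} adj)
      ((VCat.forget A).map ((VCat.free hA).map ((VGph.mapFunctor F).map f))) := by
  obtain ⟨o, m, rfl⟩ := VGph.exists_eq_homMk f
  let S := star fun x y => F.obj (G.hom x y)
  let S' := star fun x y => F.obj (H.hom x y)
  let s : ∀ x y, S x y ⟶ S' (o x) (o y) := starMap fun x y => F.map (m x y)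
  have key : ∀ x y, CounitCartesian adj (s x y) := CounitCartesian.starMap hA fun x y => h _
  rw [VCat.forget_map_free_map]
  exact VGph.isPullback_of_id (M := fun x y => F.obj (U.obj (S x y))) (N := S)
    (M' := fun x y => F.obj (U.obj (S' x y))) (N' := S') (t := fun x y => F.map (U.map (s x y)))
    (b := s) (l := fun x y => adj.counit.app _) (r := fun x y => adj.counit.app _) key

lemma step [CartesianMonoidalCategory A] (h : IsCartesianForgetful.{w} U) :
    IsCartesianForgetful.{w} (VCat.forget.{w} A ⋙ VGph.mapFunctor.{w} U) := by
  obtain ⟨hpA, hpB, hA, hU, F, adj, hF, hη, hε⟩ := h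
  have hcA := hA.hasCoproducts
  have hpC := VCat.hasPullbacks.{w} (A := A)
  have hcf := VCat.preservesCoproducts_forget hA
  have hcm := VGph.preservesCoproducts_mapFunctor hcA U
  have hlf : PreservesLimitsOfSize.{0, 0} (VCat.forget.{w} A) :=
    (VCat.freeAdj hA).rightAdjoint_preservesLimits
  have hlm : PreservesLimitsOfSize.{0, 0} (VGph.mapFunctor.{w} U) :=
    (VGph.mapAdjunction adj).rightAdjoint_preservesLimits
  have hfm := VGph.preservesPullbacks_mapFunctor.{w} F
  have hff := VCat.preservesPullbacks_free hA
  refine ⟨hpC, inferInstance, .of_functor (VCat.forget A) (VCat.hasCoproducts hA)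
    (VGph.hasVanKampenCoproducts hA), fun I => inferInstance,
    VGph.mapFunctor F ⋙ VCat.free hA, (VGph.mapAdjunction adj).comp (VCat.freeAdj hA),
    inferInstance, fun G H f => ?_, fun {G H} f => ?_⟩
  -- The unit of the composite adjunction is the hom-wise unit of `adj` followed by the image of the
  -- free category unit under `U`-Gph, which preserves pullbacks.
  · have h₁ : IsPullback f ((VGph.mapAdjunction.{w} adj).unit.app G)
        ((VGph.mapAdjunction.{w} adj).unit.app H)
        ((VGph.mapFunctor U).map ((VGph.mapFunctor F).map f)) :=
      VGph.isPullback_of_id fun x y => hη (VGph.Hom.map (G := G) (H := H) f x y)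
    have h₂ := (VCat.equifibered_unit hA ((VGph.mapFunctor F).map f)).map (VGph.mapFunctor U)
    have := h₁.paste_vert h₂
    rw [Adjunction.comp_unit_app, Adjunction.comp_unit_app]
    exact this
  -- The counit of the composite is `free` applied to the hom-wise counit of `adj`, followed by the
  -- free category counit; the first square survives because `free` preserves pullbacks.
  · have h₁ := (isPullback_counit_mapAdjunction hA hε f).map (VCat.free hA)
    have h₂ := VCat.isPullback_counit hA ((VGph.mapFunctor F).map f)
    have := h₁.paste_vert h₂
    rw [CounitCartesian, Adjunction.comp_counit_app, Adjunction.comp_counit_app]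
    exact this

/-- The monad generated by any adjunction `F ⊣ U` is cartesian. -/
lemma isCartesianMonad (h : IsCartesianForgetful.{w} U) (F : B ⥤ A) (adj : F ⊣ U) :
    IsCartesianMonad adj.toMonad := by
  obtain ⟨hpA, hpB, hA, hU, F', adj', hF, hη, hε⟩ := h
  let e : F' ≅ F := adj'.leftAdjointUniq adj
  have : PreservesLimitsOfSize.{0, 0} U := adj.rightAdjoint_preservesLimits
  have hF' : PreservesLimitsOfShape WalkingCospan F := preservesLimitsOfShape_of_natIso e
  refine ⟨hpB, inferInstanceAs (PreservesLimitsOfShape WalkingCospan (F ⋙ U)), ?_, ?_⟩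
  · intro X Y f
    have h₁ : IsPullback (U.map (F'.map f)) (U.map (e.hom.app X)) (U.map (e.hom.app Y))
        (U.map (F.map f)) :=
      IsPullback.of_vert_isIso ⟨by rw [← U.map_comp, e.hom.naturality, U.map_comp]⟩
    have := (hη f).paste_vert h₁
    change IsPullback f (adj.unit.app X) (adj.unit.app Y) (U.map (F.map f))
    simpa [e, Adjunction.unit_leftAdjointUniq_hom_app] using this
  · intro X Y f
    -- `F.map f` is the conjugate of `F'.map f` by the comparison isomorphism, and isomorphisms
    -- always have cartesian counit squares.
    have key : CounitCartesian adj (F.map f) := by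
      have := ((CounitCartesian.of_isIso (e.inv.app X)).comp (hε f)).comp
        (CounitCartesian.of_isIso (e.hom.app Y))
      rw [Category.assoc, e.hom.naturality, Iso.inv_hom_id_app_assoc] at this
      exact this.of_adjunction
    exact IsPullback.map U key

end IsCartesianForgetful

/-! ### Extensive categories have well-behaved coproducts -/

section

variable {V : Type u} [Category.{v} V] [HasPullbacks V] [HasCoproducts.{w} V]

/-- The first projections from the pullbacks over each `X i` assemble into a map over `∐ X` to the
coproduct of the `Y i`. By fullness it comes from a family of maps over the `X i`, and by
faithfulness this family is inverse on one side to the comparison maps into the pullbacks; the other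
side is the universal property of the pullback. -/
lemma isPullback_sigmaι_sigmaMap {I : Type w} {X Y : I → V} [(overCoprod X).IsEquivalence]
    (f : ∀ i, Y i ⟶ X i) (i : I) :
    IsPullback (Limits.Sigma.ι Y i) (f i) (Limits.Sigma.map f) (Limits.Sigma.ι X i) := by
  let P : ∀ i, Over (X i) := fun i =>
    Over.mk (pullback.snd (Limits.Sigma.map f) (Limits.Sigma.ι X i))
  let Q : ∀ i, Over (X i) := fun i => Over.mk (f i)
  have w : ∀ i, Limits.Sigma.ι Y i ≫ Limits.Sigma.map f = f i ≫ Limits.Sigma.ι X i := by simp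
  let a : (overCoprod X).obj P ⟶ (overCoprod X).obj Q :=
    Over.homMk (Limits.Sigma.desc fun i => pullback.fst (Limits.Sigma.map f) (Limits.Sigma.ι X i))
      (Limits.Sigma.hom_ext _ _ fun i => by simp [overCoprod, P, Q, pullback.condition])
  let k := (overCoprod X).preimage a
  have hk : ∀ i, (k i).left ≫ Limits.Sigma.ι Y i =
      pullback.fst (Limits.Sigma.map f) (Limits.Sigma.ι X i) := fun i => by
    have := congrArg (fun h => Limits.Sigma.ι (fun i => (P i).left) i ≫ h.left)
      ((overCoprod X).map_preimage a)
    simpa [overCoprod, a, P, Q, k] using this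
  let l : Q ⟶ P := fun i => Over.homMk (pullback.lift _ _ (w i)) (pullback.lift_snd _ _ _)
  have hl : l ≫ k = 𝟙 Q := by
    refine (overCoprod X).map_injective ?_
    ext
    refine Limits.Sigma.hom_ext _ _ fun i => ?_
    have : pullback.lift _ _ (w i) ≫ (k i).left ≫ Limits.Sigma.ι Y i = Limits.Sigma.ι Y i := by
      rw [hk, pullback.lift_fst]
    simpa [overCoprod, Q, l] using this
  refine .of_isIso_lift (w i) ⟨(k i).left, ?_, ?_⟩
  · exact congrArg (fun h => (h i).left) hl
  · have hk' : (k i).left ≫ f i = pullback.snd _ _ := Over.w (k i)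
    apply pullback.hom_ext
    · rw [Category.assoc, pullback.lift_fst, hk, Category.id_comp]
    · rw [Category.assoc, pullback.lift_snd, hk', Category.id_comp]

end

/-- Essential surjectivity writes every object over `∐ X` as a coproduct of maps;
`isPullback_sigmaι_sigmaMap` identifies its summands with the fibres, which gives universality, and
is itself disjointness. -/
lemma IsExtensive.hasVanKampenCoproducts {V : Type u} [Category.{v} V] [HasPullbacks V]
    (hV : IsExtensive.{w} V) : HasVanKampenCoproducts.{w} V := by
  have := hV.hasCoproducts
  refine .of_exists fun {I} X => ⟨_, _, isCoprod_sigma X, fun {D} g => ?_, fun Y f => ?_⟩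
  · have := hV.isEquivalence X
    let Q := (overCoprod X).objPreimage (Over.mk g)
    let e := (overCoprod X).objObjPreimageIso (Over.mk g)
    let e' : (∐ fun i => (Q i).left) ≅ D := (Over.forget _).mapIso e
    have he : e'.hom ≫ g = Limits.Sigma.map fun i => (Q i).hom := Over.w e.hom
    refine ⟨fun i => (Q i).left, fun i => Limits.Sigma.ι (fun i => (Q i).left) i ≫ e'.hom,
      fun i => (Q i).hom, fun i => ?_, (isCoprod_sigma _).comp_iso e'⟩
    refine IsPullback.of_iso (isPullback_sigmaι_sigmaMap (fun i => (Q i).hom) i) (Iso.refl _)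
      e' (Iso.refl _) (Iso.refl _) (by simp) (by simp) ?_ (by simp)
    simpa using he.symm
  · have := hV.isEquivalence X
    exact ⟨_, _, Limits.Sigma.map f, isCoprod_sigma Y, isPullback_sigmaι_sigmaMap f⟩

/-! ### The main theorem -/

lemma isCartesianForgetful_nForget {V : Type (max u v (w + 1))} [Category.{max v w} V]
    [CartesianMonoidalCategory V] [HasFiniteLimits V] (hV : IsExtensive.{w} V) (n : ℕ) :
    IsCartesianForgetful.{w} (nForget.{w, v, u} V n) := by
  induction n with
  | zero =>
    exact IsCartesianForgetful.id (inferInstanceAs (HasPullbacks V)) hV.hasVanKampenCoproducts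
  | succ n ih => exact ih.step

/-- For every `n`, the forgetful functor `V-Cat⁽ⁿ⁾ ⥤ V-Gph⁽ⁿ⁾` has a left adjoint, and the monad
generated by any adjunction `F⁽ⁿ⁾ ⊣ U⁽ⁿ⁾` is cartesian. -/
theorem mainTheorem10 {V : Type (max u v (w + 1))} [Category.{max v w} V]
    [CartesianMonoidalCategory V] [HasFiniteLimits V] (hV : IsExtensive.{w} V) (n : ℕ) :
    (nForget.{w, v, u} V n).IsRightAdjoint ∧
      ∀ (F : NGph.{w, v, u} V n ⥤ NCat.{w, v, u} V n) (adj : F ⊣ nForget.{w, v, u} V n),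
        IsCartesianMonad adj.toMonad := by
  have h := isCartesianForgetful_nForget.{w, v, u} hV n
  obtain ⟨_, adj, _⟩ := h.exists_adjunction
  exact ⟨adj.isRightAdjoint, h.isCartesianMonad⟩
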